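/- Definitions. Write $[m]=\{1,\dots,m\}$ and let $\mu$ be the uniform probability measure on $[m]^n$. For $i\in[n]$, $a\in[m]$, the set $D_{i\to a}=\{x\in[m]^n: x_i=a\}$ is called a subcube of co-dimension $1$; for a collection $\mathcal D$ of such subcubes let $\bigcup\mathcal D$ denote their union. An $\ell$-configuration $\mathcal H$ of size $h$ (where $\ell,h\ge 0$) is a finite multi-$\ell$-graph with edges $e_1,\dots,e_h$ (repetitions allowed) whose vertex set is partitioned into parts $U_1,\dots,U_\ell$ so that each edge has exactly one vertex in each part. Its kernel is the set of vertices contained in all edges, and its centre is the set of vertices contained in more than one edge (counted with multiplicity); $\mathcal H$ is flat if each part contains at most one vertex of the centre, and has no kernel if its kernel is empty. Vectors $x^1,\dots,x^h\in[m]^n$ realise $\mathcal H$ if there is an injection $\Phi:[\ell]\to[n]$ such that for all distinct $j,j'\in[h]$ and all $i\in[n]$ we have $x^j_i=x^{j'}_i$ exactly when $i=\Phi(k)$ for some $k\in[\ell]$ with $e_j\cap e_{j'}\cap U_k\neq\emptyset$. A set $\mathcal F\subset[m]^n$ is $\mathcal H$-free if no vectors $x^1,\dots,x^h\in\mathcal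 F$ realise $\mathcal H$. The crosscut $\sigma(\mathcal H)$ is the minimum $s$ such that, for all sufficiently large $m$ and $n$, every collection $\mathcal D$ of $s$ subcubes of $[m]^n$ of co-dimension $1$ contains a copy of $\mathcal H$, meaning that there are $x^1,\dots,x^h\in[m]^n$ realising $\mathcal H$ such that each $x^j$ lies in exactly one member of $\mathcal D$. Theorem. For every $\eta>0$ and every flat configuration $\mathcal H$ with no kernel there is $C$ such that, if $m,n>C$ and $\mathcal F\subset[m]^n$ is $\mathcal H$-free, then there is a collection $\mathcal D$ of fewer than $\sigma(\mathcal H)$ subcubes of $[m]^n$ of co-dimension $1$ such that $\mu(\mathcal F\setminus\bigcup\mathcal D)\le \eta/m$. -/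

import Mathlib

/-- An `ℓ`-configuration of size `h`: an `ℓ`-partite multi-`ℓ`-graph with parts
`Part 0, …, Part (ℓ - 1)` and `h` edges. Each edge has exactly one vertex in each part, so the
`j`-th edge is given by its vertex `edge j k` in `Part k`, for every `k`.
Edges may be repeated. -/
structure Configuration (ℓ h : ℕ) where
  /-- the parts -/
  Part : Fin ℓ → Type
  /-- the vertex set is finite -/
  finite_part : ∀ k, Finite (Part k)
  /-- the edges -/
  edge : Fin h → (k : Fin ℓ) → Part k

namespace Configuration

variable {ℓ h : ℕ}

/-- The kernel: the set of vertices that lie in all edges. -/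
def kernel (H : Configuration ℓ h) : Set (Σ k, H.Part k) :=
  {v | ∀ j, H.edge j v.1 = v.2}

/-- The centre: the set of vertices that lie in more than one edge (edges are counted with
multiplicity). -/
def centre (H : Configuration ℓ h) : Set (Σ k, H.Part k) :=
  {v | ∃ j j', j ≠ j' ∧ H.edge j v.1 = v.2 ∧ H.edge j' v.1 = v.2}

/-- A configuration is flat if each part has at most one vertex in the centre. -/
def IsFlat (H : Configuration ℓ h) : Prop :=
  ∀ (k : Fin ℓ) (u v : H.Part k),
    (⟨k, u⟩ : Σ k, H.Part k) ∈ H.centre → (⟨k, v⟩ : Σ k, H.Part k) ∈ H.centre → u = v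

/-- The vectors `x 0, …, x (h - 1)` of `[m]^n` realise `H`: there is an injection `Φ` of the
parts into the coordinates such that two of the vectors agree in coordinate `i` exactly when
`i = Φ k` for a part `k` in which the two corresponding edges share their vertex. -/
def IsRealisedBy (H : Configuration ℓ h) {m n : ℕ} (x : Fin h → Fin n → Fin m) : Prop :=
  ∃ Φ : Fin ℓ ↪ Fin n, ∀ j j' : Fin h, j ≠ j' → ∀ i : Fin n,
    x j i = x j' i ↔ ∃ k, i = Φ k ∧ H.edge j k = H.edge j' k

/-- The code `F ⊆ [m]^n` is `H`-free: no vectors of `F` realise `H`. -/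
def IsFree (H : Configuration ℓ h) {m n : ℕ} (F : Finset (Fin n → Fin m)) : Prop :=
  ¬ ∃ x : Fin h → Fin n → Fin m, (∀ j, x j ∈ F) ∧ H.IsRealisedBy x

end Configuration

/-- The co-dimension-1 subcube (dictator) `{x ∈ [m]^n | x_i = a}`, where `d = (i, a)`. -/
def dictator {m n : ℕ} (d : Fin n × Fin m) : Finset (Fin n → Fin m) :=
  {x | x d.1 = d.2}

/-- The union of a collection of co-dimension-1 subcubes. -/
def dictatorUnion {m n : ℕ} (D : Finset (Fin n × Fin m)) : Finset (Fin n → Fin m) :=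
  D.biUnion dictator

namespace Configuration

variable {ℓ h : ℕ}

/-- The collection `D` of co-dimension-1 subcubes contains a copy of `H`: some realisation of `H`
has each of its `h` edges (vectors) in exactly one of the subcubes of `D`. -/
def IsCutBy (H : Configuration ℓ h) {m n : ℕ} (D : Finset (Fin n × Fin m)) : Prop :=
  ∃ x : Fin h → Fin n → Fin m, H.IsRealisedBy x ∧ ∀ j, ∃! d, d ∈ D ∧ x j ∈ dictator d

/-- The crosscut `σ(H)`: the least `s` such that, in `[m]^n` for all sufficiently large `m` and
`n`, every collection of `s` co-dimension-1 subcubes contains a copy of `H` with each edge in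
exactly one of the subcubes. Such `s` exist: `s = h` is one. -/
noncomputable def crosscut (H : Configuration ℓ h) : ℕ :=
  sInf {s | ∃ N : ℕ, ∀ m n : ℕ, N ≤ m → N ≤ n →
    ∀ D : Finset (Fin n × Fin m), D.card = s → H.IsCutBy D}

end Configuration

/-! Let `D` collect the subcubes in which `F` has relative density above a constant ε. If `D` had at
least σ(H) members, then σ(H) of them would contain a copy of H with every edge in exactly one of
them, and `IsFlat.exists_isRealisedBy_of_dense` would move this copy into `F`. Otherwise remove the
union of `D`. The rest has density at most ε in every subcube, and if its measure exceeded η/m,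
`IsFlat.exists_isRealisedBy_of_sparse` would find a copy of H in it.

Both cases prescribe, for each edge, the coordinates that it shares with other edges, and must then
fill in the rest so that the vectors differ wherever they should. For this the m values in every
coordinate are split at random into q blocks, and each edge gets a block of its own
(`exists_perm_forall_exists`). The density of a restricted code in a random block has mean μ and
variance at most the sum over nonempty S of λ^|S| times the Efron–Stein weight on S, where λ is of
order q/m. Levels two and above contribute O(μ/m²), which is harmless for μ of order at least 1/m,
so only the first level matters. In the dense case the trivial bound on it suffices, as m is large.
In the sparse case the level one inequality `levelOne_le_mul` bounds it by γμ.

The prescribed coordinates are taken with small low-degree influence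
(`exists_embedding_influence_le`), so that fixing them does not spoil the density (dense case) or
create first level weight (sparse case). By flatness all edges meeting in a part do so in the same
vertex, so one point y can supply the common values of all of them. -/

open Finset
open scoped BigOperators

set_option linter.unusedSectionVars false

/-! ### Averages over product spaces. -/

namespace ProductSpace

variable {ι α : Type*} [Fintype ι] [DecidableEq ι] [Fintype α] [DecidableEq α]

/-- Resampling: overwriting a uniform point by an independent uniform point on a set of
coordinates gives a uniform point. -/
lemma expect_piecewise (T : Finset ι) (φ : (ι → α) → ℝ) :
    𝔼 y : ι → α, 𝔼 x : ι → α, φ (T.piecewise y x) = 𝔼 x, φ x := by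
  cases isEmpty_or_nonempty (ι → α) with
  | inl h => simp [Finset.univ_eq_empty]
  | inr h =>
    -- Exchanging the coordinates in `T` between two independent points preserves the uniform
    -- measure on pairs.
    have hinv : Function.Involutive
        (fun p : (ι → α) × (ι → α) => (T.piecewise p.1 p.2, T.piecewise p.2 p.1)) := by
      rintro ⟨a, b⟩
      ext i <;> by_cases hi : i ∈ T <;> simp [hi]
    calc 𝔼 y : ι → α, 𝔼 x : ι → α, φ (T.piecewise y x)
        = 𝔼 p : (ι → α) × (ι → α), φ (T.piecewise p.1 p.2) := by
          rw [← univ_product_univ, expect_product]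
      _ = 𝔼 p : (ι → α) × (ι → α), φ p.1 :=
          Fintype.expect_equiv hinv.toPerm _ _ (fun _ => rfl)
      _ = 𝔼 x, φ x := by
          rw [← univ_product_univ, expect_product]
          simp

lemma expect_mul_of_indep (T : Finset ι) (F G : (ι → α) → ℝ)
    (hF : ∀ x y, F (T.piecewise y x) = F x) (hG : ∀ x y, G (T.piecewise y x) = G y) :
    𝔼 x, F x * G x = (𝔼 x, F x) * 𝔼 x, G x := by
  rw [← expect_piecewise T (fun x => F x * G x)]
  simp only [hF, hG, ← expect_mul, ← mul_expect]

lemma expect_prod (φ : ι → α → ℝ) :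
    𝔼 w : ι → α, ∏ i, φ i (w i) = ∏ i, 𝔼 a, φ i a := by
  simp only [Fintype.expect_eq_sum_div_card, prod_div_distrib, prod_const, card_univ,
    Fintype.card_fun, Nat.cast_pow]
  rw [prod_univ_sum, Fintype.piFinset_univ]

lemma expect_prod_finset [Nonempty α] (S : Finset ι) (φ : ι → α → ℝ) :
    𝔼 w : ι → α, ∏ i ∈ S, φ i (w i) = ∏ i ∈ S, 𝔼 a, φ i a := by
  have h := expect_prod (fun i a => if i ∈ S then φ i a else 1)
  have h1 : ∀ w : ι → α, ∏ i, (if i ∈ S then φ i (w i) else 1) = ∏ i ∈ S, φ i (w i) := by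
    intro w; simp [prod_ite_mem]
  simp only [h1] at h
  rw [h, ← prod_subset (subset_univ S)]
  · exact prod_congr rfl fun i hi => by simp [hi]
  · intro i _ hi; simp [hi]

/-- `card α` times the indicator of equality. -/
def diag (a b : α) : ℝ := if a = b then (Fintype.card α : ℝ) else 0

/-- The kernel of the projection on the functions of mean zero. -/
def centred (a b : α) : ℝ := diag a b - 1

lemma diag_comm (a b : α) : diag a b = diag b a := by
  simp [diag, eq_comm]

lemma centred_comm (a b : α) : centred a b = centred b a := by
  simp [centred, diag_comm]

lemma expect_mul_diag [Nonempty α] (φ : α → ℝ) (a : α) : 𝔼 b, φ b * diag b a = φ a := by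
  have : (Fintype.card α : ℝ) ≠ 0 := by positivity
  rw [Fintype.expect_eq_sum_div_card]
  simp [diag, this]

lemma expect_diag [Nonempty α] (a : α) : 𝔼 b, diag b a = 1 := by
  simpa using expect_mul_diag (fun _ => 1) a

lemma expect_centred [Nonempty α] (a : α) : 𝔼 b, centred b a = 0 := by
  simp only [centred, expect_sub_distrib, expect_diag, Fintype.expect_const, sub_self]

lemma expect_centred_mul_centred [Nonempty α] (a b : α) :
    𝔼 c, centred a c * centred c b = centred a b := by
  have : ∀ c, centred a c * centred c b = centred a c * diag c b - centred c a := by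
    intro c; rw [centred_comm c a]; simp only [centred]; ring
  simp only [this, expect_sub_distrib, expect_mul_diag, expect_centred, sub_zero]

/-- The product of the `diag` factors is the density of the uniform measure conditioned on agreeing
with `z` on `U`. -/
lemma expect_piecewise_eq [Nonempty α] (U : Finset ι) (φ : (ι → α) → ℝ) (z : ι → α) :
    𝔼 x, φ (U.piecewise z x) = 𝔼 x, φ x * ∏ i ∈ U, diag (x i) (z i) := by
  rw [← expect_piecewise U (fun x => φ x * ∏ i ∈ U, diag (x i) (z i))]
  have h : ∀ y x : ι → α, φ (U.piecewise y x) * ∏ i ∈ U, diag (U.piecewise y x i) (z i)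
      = φ (U.piecewise z x) * ∏ i ∈ U, diag (y i) (z i) := by
    intro y x
    have h1 : ∏ i ∈ U, diag (U.piecewise y x i) (z i) = ∏ i ∈ U, diag (y i) (z i) :=
      prod_congr rfl fun i hi => by simp [hi]
    rw [h1]
    by_cases hy : ∀ i ∈ U, y i = z i
    · have : U.piecewise y x = U.piecewise z x := by
        ext i; by_cases hi : i ∈ U <;> simp [hi, hy]
      rw [this]
    · push Not at hy
      obtain ⟨i, hi, hne⟩ := hy
      rw [prod_eq_zero hi (by simp [diag, hne])]; simp
  simp only [h, ← expect_mul, ← mul_expect]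
  rw [expect_prod_finset U (fun i a => diag a (z i))]
  simp [expect_diag]

/-! ### Efron–Stein weights and random restrictions. -/

/-- The Fourier (Efron–Stein) weight of `f` on the set `S` of coordinates. -/
noncomputable def weight (f : (ι → α) → ℝ) (S : Finset ι) : ℝ :=
  𝔼 x, 𝔼 z, f x * f z * ∏ i ∈ S, centred (x i) (z i)

/-- The second moment of the conditional expectation of `f` on the coordinates in `U`. -/
noncomputable def condEnergy (f : (ι → α) → ℝ) (U : Finset ι) : ℝ :=
  𝔼 z, f z * 𝔼 x, f (U.piecewise z x)

/-- The total weight of `f` on single coordinates. -/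
noncomputable def levelOne (f : (ι → α) → ℝ) : ℝ := ∑ i, weight f {i}

/-- `centred` is the kernel of a symmetric idempotent operator, so the weight is the squared norm of
a projection of `f`. -/
lemma weight_nonneg [Nonempty α] (f : (ι → α) → ℝ) (S : Finset ι) : 0 ≤ weight f S := by
  have h : weight f S = 𝔼 w : ι → α, (𝔼 x, f x * ∏ i ∈ S, centred (x i) (w i)) ^ 2 := by
    have h1 : ∀ x z : ι → α, ∏ i ∈ S, centred (x i) (z i)
        = 𝔼 w : ι → α, ∏ i ∈ S, (centred (x i) (w i) * centred (w i) (z i)) := by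
      intro x z
      rw [expect_prod_finset S (fun i c => centred (x i) c * centred c (z i))]
      simp [expect_centred_mul_centred]
    have h2 : ∀ w : ι → α, (𝔼 x, f x * ∏ i ∈ S, centred (x i) (w i)) ^ 2
        = 𝔼 x, 𝔼 z, f x * f z * ∏ i ∈ S, (centred (x i) (w i) * centred (w i) (z i)) := by
      intro w
      rw [sq, expect_mul_expect]
      refine expect_congr rfl fun x _ => expect_congr rfl fun z _ => ?_
      rw [prod_mul_distrib, prod_congr rfl fun i _ => centred_comm (w i) (z i)]
      ring
    simp only [h2, weight]
    conv_rhs => rw [expect_comm]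
    refine expect_congr rfl fun x _ => ?_
    conv_rhs => rw [expect_comm]
    refine expect_congr rfl fun z _ => ?_
    rw [← mul_expect, ← h1]
  rw [h]
  exact expect_nonneg fun _ _ => sq_nonneg _

/-- With `c = 1` the kernel is that of conditional expectation on `U`; with small `c` it is a noise
operator, the form in which random blocks appear. -/
lemma expect_mul_prod_one_add (f : (ι → α) → ℝ) (U : Finset ι) (c : ℝ) :
    𝔼 x, 𝔼 z, f x * f z * ∏ i ∈ U, (1 + c * centred (x i) (z i))
      = ∑ S ∈ U.powerset, c ^ #S * weight f S := by
  simp only [prod_one_add, prod_mul_distrib, prod_const, weight, mul_sum, expect_sum_comm,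
    mul_expect]
  refine sum_congr rfl fun S _ => expect_congr rfl fun x _ => expect_congr rfl fun z _ => ?_
  ring

lemma condEnergy_eq_sum_weight [Nonempty α] (f : (ι → α) → ℝ) (U : Finset ι) :
    condEnergy f U = ∑ S ∈ U.powerset, weight f S := by
  have h := expect_mul_prod_one_add f U 1
  simp only [one_pow, one_mul] at h
  rw [← h]
  refine expect_congr rfl fun z _ => ?_
  rw [expect_piecewise_eq, mul_expect]
  refine expect_congr rfl fun x _ => ?_
  rw [mul_assoc]
  congr 2
  exact prod_congr rfl fun i _ => by rw [diag_comm]; simp [centred]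

lemma weight_empty (f : (ι → α) → ℝ) : weight f ∅ = (𝔼 x, f x) ^ 2 := by
  simp [weight, sq, expect_mul_expect]

lemma sum_weight [Nonempty α] (f : (ι → α) → ℝ) : ∑ S, weight f S = 𝔼 x, f x ^ 2 := by
  rw [← powerset_univ, ← condEnergy_eq_sum_weight]
  simp [condEnergy, sq]

lemma weight_singleton [Nonempty α] (f : (ι → α) → ℝ) (i : ι) :
    weight f {i} = condEnergy f {i} - condEnergy f ∅ := by
  simp only [condEnergy_eq_sum_weight]
  have h := sum_powerset_insert (notMem_empty i) (weight f)
  simp only [insert_empty_eq, powerset_empty, sum_singleton] at h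
  simp [h]

lemma piecewise_piecewise_union (T U : Finset ι) (y z x : ι → α) :
    T.piecewise y (U.piecewise z x) = (T ∪ U).piecewise (T.piecewise y z) x := by
  ext i
  by_cases hT : i ∈ T <;> by_cases hU : i ∈ U <;> simp [piecewise, hT, hU]

/-- The restriction of `f` obtained by fixing the coordinates in `T` as in `y`, regarded as a
function on the whole cube. -/
def pin (f : (ι → α) → ℝ) (T : Finset ι) (y x : ι → α) : ℝ := f (T.piecewise y x)

lemma expect_condEnergy_pin (f : (ι → α) → ℝ) (T U : Finset ι) :
    𝔼 y, condEnergy (pin f T y) U = condEnergy f (T ∪ U) := by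
  simp only [condEnergy, pin, piecewise_piecewise_union]
  exact expect_piecewise T (fun u => f u * 𝔼 x, f ((T ∪ U).piecewise u x))

lemma condEnergy_eq_expect_sq (f : (ι → α) → ℝ) (T : Finset ι) :
    condEnergy f T = 𝔼 y, (𝔼 x, pin f T y x) ^ 2 := by
  have h := expect_condEnergy_pin f T ∅
  rw [union_empty] at h
  rw [← h]
  simp [condEnergy, pin, sq, expect_mul]

/-- Averaging over the fixed values, a restriction of `f` has the first level weight of `f`, plus
the weight of `f` on some sets that meet the set of fixed coordinates. -/
lemma expect_levelOne_pin [Nonempty α] (f : (ι → α) → ℝ) (T : Finset ι) :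
    𝔼 y, levelOne (pin f T y)
      ≤ levelOne f + ∑ S with #S ≤ #T + 1 ∧ (S ∩ T).Nonempty, weight f S := by
  have h1 : 𝔼 y, levelOne (pin f T y)
      = ∑ i, (condEnergy f (T ∪ {i}) - condEnergy f T) := by
    simp only [levelOne, weight_singleton, expect_sum_comm, expect_sub_distrib,
      expect_condEnergy_pin, union_empty]
  have h2 : ∀ i, condEnergy f (T ∪ {i}) - condEnergy f T
      = ∑ S with S ⊆ T ∪ {i} ∧ ¬ S ⊆ T, weight f S := by
    intro i
    rw [condEnergy_eq_sum_weight, condEnergy_eq_sum_weight, sub_eq_iff_eq_add,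
      ← sum_sdiff (powerset_mono.2 (subset_union_left (s₁ := T) (s₂ := {i})))]
    congr 2
    ext S; simp
  -- Such an S satisfies S \ T = {i}: either S is the singleton, or it meets T.
  have h3 : ∀ i, ∑ S with S ⊆ T ∪ {i} ∧ ¬ S ⊆ T, weight f S
      ≤ weight f {i} + ∑ S with #S ≤ #T + 1 ∧ (S ∩ T).Nonempty ∧ S \ T = {i}, weight f S := by
    intro i
    have hn : ({i} : Finset ι) ∉
        ({S | #S ≤ #T + 1 ∧ (S ∩ T).Nonempty ∧ S \ T = {i}} : Finset (Finset ι)) := by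
      simp only [mem_filter, mem_univ, true_and, not_and]
      rintro - ⟨j, hj⟩ h
      have hi : i ∈ ({i} : Finset ι) \ T := by rw [h]; simp
      simp at hj hi
      exact hi (hj.1 ▸ hj.2)
    rw [← sum_insert (f := weight f) hn]
    refine sum_le_sum_of_subset_of_nonneg ?_ fun S _ _ => weight_nonneg f S
    intro S hS
    simp only [mem_filter, mem_univ, true_and, mem_insert] at hS ⊢
    obtain ⟨hS1, hS2⟩ := hS
    have hsd : S \ T = {i} := by
      apply eq_singleton_iff_unique_mem.2
      have hall : ∀ x ∈ S \ T, x = i := by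
        intro x hx
        have := hS1 (mem_sdiff.1 hx).1
        simp only [mem_union, mem_singleton] at this
        exact this.resolve_left (mem_sdiff.1 hx).2
      obtain ⟨x, hx, hxT⟩ := not_subset.1 hS2
      have hm : x ∈ S \ T := mem_sdiff.2 ⟨hx, hxT⟩
      exact ⟨hall x hm ▸ hm, hall⟩
    rcases (S ∩ T).eq_empty_or_nonempty with he | hne
    · left
      rw [← hsd]
      exact (sdiff_eq_self_of_disjoint (disjoint_iff_inter_eq_empty.2 he)).symm
    · right
      refine ⟨?_, hne, hsd⟩
      calc #S ≤ #(T ∪ {i}) := card_le_card hS1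
        _ ≤ #T + 1 := by simpa using card_union_le T {i}
  rw [h1, levelOne]
  simp only [h2]
  refine (sum_le_sum fun i _ => h3 i).trans ?_
  rw [sum_add_distrib]
  gcongr
  -- S \ T determines i, so no set is counted twice.
  have hdisj : ∀ i ∈ (univ : Finset ι), ∀ j ∈ (univ : Finset ι), i ≠ j → Disjoint
      ({S | #S ≤ #T + 1 ∧ (S ∩ T).Nonempty ∧ S \ T = {i}} : Finset (Finset ι))
      ({S | #S ≤ #T + 1 ∧ (S ∩ T).Nonempty ∧ S \ T = {j}} : Finset (Finset ι)) := by
    intro i _ j _ hij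
    rw [disjoint_left]
    intro S hS hS'
    simp only [mem_filter, mem_univ, true_and] at hS hS'
    exact hij (singleton_injective (hS.2.2.symm.trans hS'.2.2))
  rw [← sum_biUnion hdisj]
  refine sum_le_sum_of_subset_of_nonneg ?_ fun S _ _ => weight_nonneg f S
  intro S hS
  simp only [mem_biUnion, mem_filter, mem_univ, true_and] at hS ⊢
  obtain ⟨i, h, h', -⟩ := hS
  exact ⟨h, h'⟩

/-- A weight depending only on the coordinates in `T` sees `f` only through its conditional mean
given them. -/
lemma expect_mul_expect_pin (f φ : (ι → α) → ℝ) (T : Finset ι)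
    (hφ : ∀ x y, φ (T.piecewise y x) = φ y) :
    𝔼 y, f y * φ y = 𝔼 y, (𝔼 x, pin f T y x) * φ y := by
  rw [← expect_piecewise T (fun y => f y * φ y)]
  simp only [hφ, pin, ← expect_mul]

/-! ### The level one inequality. -/

lemma expect_eval [Nonempty α] (i : ι) (ψ : α → ℝ) : 𝔼 z : ι → α, ψ (z i) = 𝔼 a, ψ a := by
  simpa using expect_prod_finset {i} (fun _ : ι => ψ)

/-- The second and fourth moments of a sum of independent bounded variables of mean zero. -/
lemma moments_sum [Nonempty α] {ε : ℝ} (g : ι → α → ℝ) (hg : ∀ i, 𝔼 a, g i a = 0)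
    (hε : ∀ i a, |g i a| ≤ ε) (s : Finset ι) :
    𝔼 z : ι → α, ∑ i ∈ s, g i (z i) = 0 ∧
    𝔼 z : ι → α, (∑ i ∈ s, g i (z i)) ^ 2 = ∑ i ∈ s, 𝔼 a, g i a ^ 2 ∧
    𝔼 z : ι → α, (∑ i ∈ s, g i (z i)) ^ 4
      ≤ 3 * (∑ i ∈ s, 𝔼 a, g i a ^ 2) ^ 2 + ε ^ 2 * ∑ i ∈ s, 𝔼 a, g i a ^ 2 := by
  induction s using Finset.induction_on with
  | empty => simp
  | insert i s hi ih =>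
    obtain ⟨h1, h2, h4⟩ := ih
    have hind : ∀ p q : ℕ, 𝔼 z : ι → α, g i (z i) ^ p * (∑ i ∈ s, g i (z i)) ^ q
        = (𝔼 a, g i a ^ p) * 𝔼 z : ι → α, (∑ i ∈ s, g i (z i)) ^ q := by
      intro p q
      rw [← expect_eval i (fun a => g i a ^ p)]
      refine expect_mul_of_indep s (fun z : ι → α => g i (z i) ^ p)
        (fun z : ι → α => (∑ i ∈ s, g i (z i)) ^ q) (fun x y => by simp [hi]) fun x y => ?_
      congr 1
      exact sum_congr rfl fun j hj => by simp [hj]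
    have e1 : 𝔼 z : ι → α, g i (z i) = 0 := by rw [expect_eval i (g i), hg]
    have e2 : 𝔼 z : ι → α, g i (z i) ^ 2 = 𝔼 a, g i a ^ 2 := expect_eval i (fun a => g i a ^ 2)
    have e4 : 𝔼 z : ι → α, g i (z i) ^ 4 ≤ ε ^ 2 * 𝔼 a, g i a ^ 2 := by
      rw [expect_eval i (fun a => g i a ^ 4), mul_expect]
      refine expect_le_expect fun a _ => ?_
      have : g i a ^ 2 ≤ ε ^ 2 := sq_le_sq' (abs_le.1 (hε i a)).1 (abs_le.1 (hε i a)).2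
      nlinarith [sq_nonneg (g i a)]
    have hv : 0 ≤ 𝔼 a, g i a ^ 2 := expect_nonneg fun _ _ => sq_nonneg _
    have hV : 0 ≤ ∑ i ∈ s, 𝔼 a, g i a ^ 2 := sum_nonneg fun j _ => expect_nonneg fun _ _ => sq_nonneg _
    simp only [sum_insert hi]
    refine ⟨by rw [expect_add_distrib, h1, e1, add_zero], ?_, ?_⟩
    · have hexp : ∀ z : ι → α, (g i (z i) + ∑ i ∈ s, g i (z i)) ^ 2
          = g i (z i) ^ 2 + 2 * (g i (z i) ^ 1 * (∑ i ∈ s, g i (z i)) ^ 1)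
            + (∑ i ∈ s, g i (z i)) ^ 2 := by intro z; ring
      simp only [hexp, expect_add_distrib, ← mul_expect, hind]
      rw [e2, h2]
      simp [hg]
    -- By independence the terms with a factor of degree one vanish; only the squares product and
    -- the two fourth powers survive.
    · have hexp : ∀ z : ι → α, (g i (z i) + ∑ i ∈ s, g i (z i)) ^ 4
          = g i (z i) ^ 4 + 4 * (g i (z i) ^ 3 * (∑ i ∈ s, g i (z i)) ^ 1)
            + 6 * (g i (z i) ^ 2 * (∑ i ∈ s, g i (z i)) ^ 2)
            + 4 * (g i (z i) ^ 1 * (∑ i ∈ s, g i (z i)) ^ 3)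
            + (∑ i ∈ s, g i (z i)) ^ 4 := by intro z; ring
      simp only [hexp, expect_add_distrib, ← mul_expect, hind]
      simp only [pow_one, hg, h1, h2, mul_zero, zero_mul, add_zero]
      nlinarith [sq_nonneg (𝔼 a, g i a ^ 2)]

/-- The level one inequality: a set all of whose one-coordinate restrictions have density close to
that of the set has small weight on the first level. -/
lemma levelOne_pow_four_le [Nonempty α] {ε : ℝ} (f : (ι → α) → ℝ) (hf : ∀ x, f x = 0 ∨ f x = 1)
    (hε : ∀ i a, |𝔼 x, f x * centred (x i) a| ≤ ε) :
    levelOne f ^ 4 ≤ (𝔼 x, f x) ^ 3 * (3 * levelOne f ^ 2 + ε ^ 2 * levelOne f) := by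
  set g : ι → α → ℝ := fun i a => 𝔼 x, f x * centred (x i) a with hgdef
  have hg0 : ∀ i, 𝔼 a, g i a = 0 := by
    intro i
    simp only [hgdef]
    rw [expect_comm]
    have h : ∀ b : α, 𝔼 a, centred b a = 0 := fun b => by
      simp only [centred_comm b, expect_centred]
    simp only [← mul_expect, h, mul_zero, expect_const_zero]
  have hg2 : ∀ i, 𝔼 a, g i a ^ 2 = weight f {i} := by
    intro i
    have : ∀ a, g i a ^ 2 = 𝔼 x, 𝔼 z, f x * f z * (centred (x i) a * centred a (z i)) := by
      intro a
      rw [sq, expect_mul_expect]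
      refine expect_congr rfl fun x _ => expect_congr rfl fun z _ => ?_
      rw [centred_comm a]; ring
    simp only [this, weight, prod_singleton]
    rw [expect_comm]
    refine expect_congr rfl fun x _ => ?_
    rw [expect_comm]
    refine expect_congr rfl fun z _ => ?_
    rw [← mul_expect, expect_centred_mul_centred]
  obtain ⟨-, -, h4⟩ := moments_sum g hg0 hε univ
  simp only [hg2] at h4
  change _ ≤ 3 * levelOne f ^ 2 + ε ^ 2 * levelOne f at h4
  -- The sum is the degree one part L of `f`. Two applications of Cauchy–Schwarz, using f² = f, pass
  -- from E[fL] to the fourth moment of L.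
  have hW : levelOne f = 𝔼 z, f z * ∑ i, g i (z i) := by
    simp only [mul_sum, expect_sum_comm, levelOne, hgdef, mul_expect]
    refine sum_congr rfl fun i _ => expect_congr rfl fun x _ => expect_congr rfl fun z _ => ?_
    rw [prod_singleton, centred_comm]; ring
  set L : (ι → α) → ℝ := fun z => ∑ i, g i (z i)
  have hf2 : ∀ x, f x ^ 2 = f x := fun x => by rcases hf x with h | h <;> simp [h]
  have hμ : 0 ≤ 𝔼 x, f x := expect_nonneg fun x _ => by rcases hf x with h | h <;> simp [h]
  have c1 : levelOne f ^ 2 ≤ (𝔼 x, f x) * 𝔼 x, f x * L x ^ 2 := by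
    have := expect_mul_sq_le_sq_mul_sq univ f (fun x => f x * L x)
    simp only [mul_pow, hf2, ← mul_assoc, ← sq] at this
    rw [hW]; exact this
  have c2 : (𝔼 x, f x * L x ^ 2) ^ 2 ≤ (𝔼 x, f x) * 𝔼 x, L x ^ 4 := by
    have := expect_mul_sq_le_sq_mul_sq univ f (fun x => L x ^ 2)
    simp only [hf2, ← pow_mul] at this
    exact this
  calc levelOne f ^ 4 = (levelOne f ^ 2) ^ 2 := by ring
    _ ≤ ((𝔼 x, f x) * 𝔼 x, f x * L x ^ 2) ^ 2 := by gcongr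
    _ = (𝔼 x, f x) ^ 2 * (𝔼 x, f x * L x ^ 2) ^ 2 := by ring
    _ ≤ (𝔼 x, f x) ^ 2 * ((𝔼 x, f x) * (3 * levelOne f ^ 2 + ε ^ 2 * levelOne f)) := by
        gcongr
        exact c2.trans (by gcongr)
    _ = _ := by ring

lemma sum_weight_eq_expect [Nonempty α] (f : (ι → α) → ℝ) (hf : ∀ x, f x = 0 ∨ f x = 1) :
    ∑ S, weight f S = 𝔼 x, f x := by
  rw [sum_weight]
  exact expect_congr rfl fun x _ => by rcases hf x with h | h <;> simp [h]

lemma levelOne_nonneg [Nonempty α] (f : (ι → α) → ℝ) : 0 ≤ levelOne f :=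
  sum_nonneg fun _ _ => weight_nonneg f _

lemma levelOne_le [Nonempty α] (f : (ι → α) → ℝ) (hf : ∀ x, f x = 0 ∨ f x = 1) :
    levelOne f ≤ 𝔼 x, f x := by
  rw [← sum_weight_eq_expect f hf, levelOne,
    ← sum_image (f := weight f) (g := fun i : ι => ({i} : Finset ι)) singleton_injective.injOn]
  exact sum_le_sum_of_subset_of_nonneg (subset_univ _) fun S _ _ => weight_nonneg f S

/-- For W the first level weight, the fourth moment bound gives W³ ≤ μ³(3W + ε²). Since W ≤ μ, both
W and ε² are at most γ³/4, and 3 + 1 = 4 quarters make W³ ≤ (γμ)³. -/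
lemma levelOne_le_mul [Nonempty α] {γ : ℝ} (hγ : 0 < γ) (hγ1 : γ ≤ 1) (f : (ι → α) → ℝ)
    (hf : ∀ x, f x = 0 ∨ f x = 1) (hμ : 𝔼 x, f x ≤ γ ^ 3 / 4)
    (hε : ∀ i a, 𝔼 x, f x * diag (x i) a ≤ γ ^ 3 / 4) :
    levelOne f ≤ γ * 𝔼 x, f x := by
  have hμ0 : 0 ≤ 𝔼 x, f x := expect_nonneg fun x _ => by rcases hf x with h | h <;> simp [h]
  have hε' : ∀ i a, |𝔼 x, f x * centred (x i) a| ≤ γ ^ 3 / 4 := by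
    intro i a
    have h0 : 0 ≤ 𝔼 x, f x * diag (x i) a := expect_nonneg fun x _ => by
      have : 0 ≤ diag (x i) a := by unfold diag; split_ifs <;> positivity
      rcases hf x with h | h <;> simp [h, this]
    have := hε i a
    simp only [centred, mul_sub, expect_sub_distrib, mul_one]
    rw [abs_le]; constructor <;> linarith
  have h4 := levelOne_pow_four_le f hf hε'
  have hW0 := levelOne_nonneg f
  have hWμ := levelOne_le f hf
  set W := levelOne f
  set μ := 𝔼 x, f x
  by_contra! hlt
  have hWpos : 0 < W := lt_of_le_of_lt (by positivity) hlt
  have hε0 : γ ^ 3 / 4 ≤ 1 := by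
    have : γ ^ 3 ≤ 1 := pow_le_one₀ hγ.le hγ1
    linarith
  have hμpos : 0 < μ := hWpos.trans_le hWμ
  have h3 : W ^ 3 ≤ μ ^ 3 * γ ^ 3 := by
    have h5 : W ^ 3 * W ≤ (μ ^ 3 * (3 * W + (γ ^ 3 / 4) ^ 2)) * W := by nlinarith
    have h6 := le_of_mul_le_mul_right h5 hWpos
    refine h6.trans ?_
    have hs : (γ ^ 3 / 4) ^ 2 ≤ γ ^ 3 / 4 := by
      rw [sq]; exact mul_le_of_le_one_left (by positivity) hε0
    gcongr
    linarith
  have h7 : (γ * μ) ^ 3 < W ^ 3 := pow_lt_pow_left₀ hlt (by positivity) (by norm_num)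
  rw [mul_pow] at h7
  linarith

/-! ### Random blocks. -/

lemma expect_perm_apply [Nonempty α] (φ : α → ℝ) (a : α) :
    𝔼 π : Equiv.Perm α, φ (π a) = 𝔼 b, φ b := by
  have h1 : ∀ b, 𝔼 π : Equiv.Perm α, φ (π b) = 𝔼 π : Equiv.Perm α, φ (π a) := fun b =>
    Fintype.expect_equiv (Equiv.mulRight (Equiv.swap a b)) _ _ fun π => by simp
  have h2 : 𝔼 b, 𝔼 π : Equiv.Perm α, φ (π b) = 𝔼 b, φ b := by
    rw [expect_comm]
    have h3 : ∀ π : Equiv.Perm α, 𝔼 b, φ (π b) = 𝔼 b, φ b := fun π =>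
      Fintype.expect_equiv π _ _ fun _ => rfl
    simp only [h3, Fintype.expect_const]
  simpa only [h1, Fintype.expect_const] using h2

/-- By symmetry the correlation takes one value on the diagonal and one off it, and it averages to
1, so it is 1 plus a multiple of `centred`. -/
lemma expect_perm_mul [Nontrivial α] (φ : α → ℝ) (hφ : 𝔼 a, φ a = 1) (a b : α) :
    𝔼 π : Equiv.Perm α, φ (π a) * φ (π b)
      = 1 + ((𝔼 c, φ c ^ 2) - 1) / (Fintype.card α - 1) * centred a b := by
  have hm : (1 : ℝ) < Fintype.card α := by exact_mod_cast Fintype.one_lt_card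
  have hm' : (Fintype.card α : ℝ) - 1 ≠ 0 := by linarith
  have hd : 𝔼 π : Equiv.Perm α, φ (π a) * φ (π a) = 𝔼 c, φ c ^ 2 := by
    simpa only [sq] using expect_perm_apply (fun c => φ c * φ c) a
  by_cases hab : a = b
  · subst hab
    rw [hd]
    simp only [centred, diag, if_true]
    field_simp
    ring
  · have h1 : ∀ c, c ≠ a → 𝔼 π : Equiv.Perm α, φ (π a) * φ (π c)
        = 𝔼 π : Equiv.Perm α, φ (π a) * φ (π b) := fun c hc =>
      Fintype.expect_equiv (Equiv.mulRight (Equiv.swap b c)) _ _ fun π => by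
        simp [Equiv.swap_apply_of_ne_of_ne hab hc.symm]
    have h2 : 𝔼 c, 𝔼 π : Equiv.Perm α, φ (π a) * φ (π c) = 1 := by
      rw [expect_comm]
      have h3 : ∀ π : Equiv.Perm α, 𝔼 c, φ (π c) = 1 := fun π => by
        rw [← hφ]; exact Fintype.expect_equiv π _ _ fun _ => rfl
      simp only [← mul_expect, h3, mul_one]
      rw [expect_perm_apply, hφ]
    rw [Fintype.expect_eq_sum_div_card, ← add_sum_erase univ _ (mem_univ a),
      sum_congr rfl fun c hc => h1 c (ne_of_mem_erase hc), hd, sum_const, card_erase_of_mem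
        (mem_univ a), card_univ, nsmul_eq_mul, Nat.cast_sub Fintype.card_pos, div_eq_one_iff_eq
        (by linarith)] at h2
    simp only [centred, diag, hab, if_false]
    push_cast at h2
    field_simp
    linarith

/-- The second moment bound for the density of `f` in a random block. -/
lemma sum_pow_mul_weight_le [Nonempty α] (f : (ι → α) → ℝ) {c : ℝ} (hc : 0 ≤ c) (hc1 : c ≤ 1) :
    ∑ S, c ^ #S * weight f S
      ≤ (𝔼 x, f x) ^ 2 + c * levelOne f + c ^ 2 * 𝔼 x, f x ^ 2 := by
  have hterm : ∀ S : Finset ι, c ^ #S * weight f S ≤ (if S = ∅ then weight f S else 0)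
      + (if #S = 1 then c * weight f S else 0) + c ^ 2 * weight f S := by
    intro S
    have hw := weight_nonneg f S
    rcases Nat.lt_trichotomy #S 1 with h | h | h
    · have : S = ∅ := card_eq_zero.1 (by omega)
      subst this
      simp only [card_empty, pow_zero, one_mul, if_true, zero_ne_one, if_false]
      nlinarith [mul_nonneg (sq_nonneg c) hw]
    · have : S ≠ ∅ := by rintro rfl; simp at h
      simp only [h, this, if_true, if_false, pow_one]
      nlinarith [mul_nonneg (sq_nonneg c) hw]
    · have : S ≠ ∅ := by rintro rfl; simp at h
      simp only [h.ne', this, if_false, zero_add]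
      exact mul_le_mul_of_nonneg_right (pow_le_pow_of_le_one hc hc1 h) hw
  refine (sum_le_sum fun S _ => hterm S).trans_eq ?_
  rw [sum_add_distrib, sum_add_distrib, ← mul_sum, sum_weight]
  congr 2
  · simp [weight_empty]
  · rw [← sum_filter, ← mul_sum, levelOne]
    congr 1
    rw [← sum_image (f := weight f) (g := fun i : ι => ({i} : Finset ι))
      singleton_injective.injOn]
    refine sum_congr ?_ fun _ _ => rfl
    ext S
    simp [card_eq_one, eq_comm]

/-- Independence over coordinates turns the two-point correlation into a product of noise kernels,
so the second moment is a noise stability. -/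
lemma expect_sq_block [Nontrivial α] (f : (ι → α) → ℝ) (φ : α → ℝ) (hφ : 𝔼 a, φ a = 1) :
    𝔼 π : ι → Equiv.Perm α, (𝔼 x, f x * ∏ i, φ (π i (x i))) ^ 2
      = ∑ S, (((𝔼 c, φ c ^ 2) - 1) / (Fintype.card α - 1)) ^ #S * weight f S := by
  rw [← powerset_univ, ← expect_mul_prod_one_add]
  have h : ∀ π : ι → Equiv.Perm α, (𝔼 x, f x * ∏ i, φ (π i (x i))) ^ 2
      = 𝔼 x, 𝔼 z, f x * f z * ∏ i, (φ (π i (x i)) * φ (π i (z i))) := by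
    intro π
    rw [sq, expect_mul_expect]
    refine expect_congr rfl fun x _ => expect_congr rfl fun z _ => ?_
    rw [prod_mul_distrib]; ring
  simp only [h]
  rw [expect_comm]
  refine expect_congr rfl fun x _ => ?_
  rw [expect_comm]
  refine expect_congr rfl fun z _ => ?_
  rw [← mul_expect, expect_prod (fun i (π : Equiv.Perm α) => φ (π (x i)) * φ (π (z i)))]
  simp only [expect_perm_mul φ hφ]

lemma expect_block [Nonempty α] (f : (ι → α) → ℝ) (φ : α → ℝ) (hφ : 𝔼 a, φ a = 1) :
    𝔼 π : ι → Equiv.Perm α, 𝔼 x, f x * ∏ i, φ (π i (x i)) = 𝔼 x, f x := by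
  rw [expect_comm]
  refine expect_congr rfl fun x _ => ?_
  rw [← mul_expect, expect_prod (fun i (π : Equiv.Perm α) => φ (π (x i)))]
  simp [expect_perm_apply, hφ]

lemma expect_block_eq_zero_le [Nontrivial α] (f : (ι → α) → ℝ) (φ : α → ℝ)
    (hφ : 𝔼 a, φ a = 1) {c : ℝ} (hc1 : c ≤ 1)
    (hc : (𝔼 a, φ a ^ 2) - 1 ≤ c * (Fintype.card α - 1)) :
    (𝔼 π : ι → Equiv.Perm α, if 𝔼 x, f x * ∏ i, φ (π i (x i)) = 0 then (1 : ℝ) else 0)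
        * (𝔼 x, f x) ^ 2
      ≤ c * levelOne f + c ^ 2 * 𝔼 x, f x ^ 2 := by
  have hm : (1 : ℝ) < Fintype.card α := by exact_mod_cast Fintype.one_lt_card
  set lam : ℝ := ((𝔼 c, φ c ^ 2) - 1) / (Fintype.card α - 1)
  have hlam : lam ≤ c := (div_le_iff₀ (by linarith)).2 hc
  have hlam0 : 0 ≤ lam := by
    refine div_nonneg ?_ (by linarith)
    have h := expect_mul_sq_le_sq_mul_sq univ φ (fun _ => (1 : ℝ))
    simp only [mul_one, hφ, one_pow, Fintype.expect_const] at h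
    linarith
  set Z : (ι → Equiv.Perm α) → ℝ := fun π => 𝔼 x, f x * ∏ i, φ (π i (x i))
  set μ := 𝔼 x, f x
  have hZ1 : 𝔼 π, Z π = μ := expect_block f φ hφ
  have hZ2 : 𝔼 π, Z π ^ 2 ≤ μ ^ 2 + lam * levelOne f + lam ^ 2 * 𝔼 x, f x ^ 2 :=
    (expect_sq_block f φ hφ).trans_le (sum_pow_mul_weight_le f hlam0 (hlam.trans hc1))
  have hvar : 𝔼 π, (Z π - μ) ^ 2 = (𝔼 π, Z π ^ 2) - μ ^ 2 := by
    have : ∀ π, (Z π - μ) ^ 2 = Z π ^ 2 - 2 * μ * Z π + μ ^ 2 := fun π => by ring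
    simp only [this, expect_add_distrib, expect_sub_distrib, ← mul_expect, hZ1,
      Fintype.expect_const]
    ring
  -- Chebyshev: an empty block deviates from the mean by μ.
  have hch : (𝔼 π, if Z π = 0 then (1 : ℝ) else 0) * μ ^ 2 ≤ 𝔼 π, (Z π - μ) ^ 2 := by
    rw [expect_mul]
    refine expect_le_expect fun π _ => ?_
    split_ifs with h
    · rw [h]; simp
    · simpa using sq_nonneg _
  have hf2 : 0 ≤ 𝔼 x, f x ^ 2 := expect_nonneg fun _ _ => sq_nonneg _
  have hl := levelOne_nonneg f
  calc _ ≤ lam * levelOne f + lam ^ 2 * 𝔼 x, f x ^ 2 := by linarith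
    _ ≤ _ := by gcongr

/-- Random blocks: if the functions `f j` have little weight on the first level, then the values
in each coordinate can be coloured so that the support of each `f j` meets each monochromatic
block. -/
lemma exists_perm_forall_exists [Nontrivial α] {h q : ℕ} (col : α → Fin q)
    (hcol : ∀ c, Fintype.card α ≤ 2 * q * #{a | col a = c}) (hq : 4 * q ≤ Fintype.card α)
    (f : Fin h → (ι → α) → ℝ)
    (hf : ∀ j, 4 * q / Fintype.card α * levelOne (f j)
      + (4 * q / Fintype.card α) ^ 2 * 𝔼 x, f j x ^ 2 < (𝔼 x, f j x) ^ 2 / (h * q + 1)) :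
    ∃ π : ι → Equiv.Perm α, ∀ j c, ∃ x, f j x ≠ 0 ∧ ∀ i, col (π i (x i)) = c := by
  have hm : (1 : ℝ) < Fintype.card α := by exact_mod_cast Fintype.one_lt_card
  set m : ℝ := (Fintype.card α : ℝ) with hmdef
  set φ : Fin q → α → ℝ := fun c a => if col a = c then m / #{a | col a = c} else 0 with hφdef
  have hB : ∀ c, (0 : ℝ) < #{a | col a = c} := by
    intro c
    have h1 := hcol c
    have h2 : 0 < Fintype.card α := Fintype.card_pos
    rcases Nat.eq_zero_or_pos #{a | col a = c} with h0 | h0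
    · rw [h0] at h1; omega
    · exact_mod_cast h0
  have hφ1 : ∀ c, 𝔼 a, φ c a = 1 := by
    intro c
    have := (hB c).ne'
    rw [Fintype.expect_eq_sum_div_card, ← sum_filter, sum_const, nsmul_eq_mul,
      mul_div_cancel₀ _ this, ← hmdef, div_self (zero_lt_one.trans hm).ne']
  have hφ2 : ∀ c, 𝔼 a, φ c a ^ 2 = m / #{a | col a = c} := by
    intro c
    have : ∀ a, φ c a ^ 2 = m / #{a | col a = c} * φ c a := by
      intro a; simp only [hφdef]; split_ifs <;> ring
    simp only [this, ← mul_expect, hφ1, mul_one]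
  -- Each block has at least m/(2q) values, so the second moment is at most 2q; the remaining factor
  -- 2 pays for m/(m - 1) ≤ 2.
  have hφ3 : ∀ c, (𝔼 a, φ c a ^ 2) - 1 ≤ 4 * q / m * (m - 1) := by
    intro c
    have h1 : m / #{a | col a = c} ≤ 2 * q := by
      rw [div_le_iff₀ (hB c), hmdef]
      exact_mod_cast hcol c
    have h2 : (2 : ℝ) ≤ m := by
      have : 2 ≤ Fintype.card α := Fintype.one_lt_card
      rw [hmdef]; exact_mod_cast this
    have h3 : (2 : ℝ) * q ≤ 4 * q / m * (m - 1) := by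
      rw [div_mul_eq_mul_div, le_div_iff₀ (by linarith)]
      have : (0 : ℝ) ≤ q := Nat.cast_nonneg q
      nlinarith
    rw [hφ2]; linarith
  have hc1 : 4 * q / m ≤ 1 := by
    rw [div_le_one (by linarith), hmdef]
    exact_mod_cast hq
  have hbad : ∀ j c, (𝔼 π : ι → Equiv.Perm α,
      if 𝔼 x, f j x * ∏ i, φ c (π i (x i)) = 0 then (1 : ℝ) else 0) ≤ 1 / (h * q + 1) := by
    intro j c
    have h1 := expect_block_eq_zero_le (f j) (φ c) (hφ1 c) hc1 (hφ3 c)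
    have h2 := h1.trans_lt (hf j)
    by_contra! hlt
    have h3 : (𝔼 x, f j x) ^ 2 / (h * q + 1) ≤ (𝔼 π : ι → Equiv.Perm α,
      if 𝔼 x, f j x * ∏ i, φ c (π i (x i)) = 0 then (1 : ℝ) else 0) * (𝔼 x, f j x) ^ 2 := by
      rw [div_eq_mul_one_div, mul_comm]
      gcongr
    exact absurd h2 (not_lt.2 h3)
  -- Union bound over the hq pairs of a function and a colour.
  have hsum : 𝔼 π : ι → Equiv.Perm α, ∑ j, ∑ c,
      (if 𝔼 x, f j x * ∏ i, φ c (π i (x i)) = 0 then (1 : ℝ) else 0) < 1 := by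
    simp only [expect_sum_comm]
    refine (sum_le_sum fun j _ => sum_le_sum fun c _ => hbad j c).trans_lt ?_
    simp only [sum_const, card_univ, Fintype.card_fin, nsmul_eq_mul]
    rw [← mul_assoc, mul_one_div, div_lt_one (by positivity)]
    linarith
  obtain ⟨π, -, hπ⟩ := exists_lt_of_expect_lt univ_nonempty hsum
  refine ⟨π, fun j c => ?_⟩
  have hne : 𝔼 x, f j x * ∏ i, φ c (π i (x i)) ≠ 0 := by
    intro h0
    have hn : ∀ j c, (0 : ℝ) ≤ if 𝔼 x, f j x * ∏ i, φ c (π i (x i)) = 0 then (1 : ℝ) else 0 :=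
      fun j c => by split_ifs <;> norm_num
    have h1 := single_le_sum (fun c _ => hn j c) (mem_univ c)
    have h2 := single_le_sum (f := fun j => ∑ c,
      if 𝔼 x, f j x * ∏ i, φ c (π i (x i)) = 0 then (1 : ℝ) else 0)
      (fun j _ => sum_nonneg fun c _ => hn j c) (mem_univ j)
    simp only [h0, if_true] at h1 h2
    linarith
  obtain ⟨x, -, hx⟩ := exists_ne_zero_of_expect_ne_zero hne
  refine ⟨x, left_ne_zero_of_mul hx, fun i => ?_⟩
  have := prod_ne_zero_iff.1 (right_ne_zero_of_mul hx) i (mem_univ i)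
  by_contra hci
  exact this (by simp [hφdef, hci])

end ProductSpace

/-- Every residue class has at least ⌊m/q⌋ ≥ 1 elements, and ⌊m/q⌋ + 1 ≤ 2⌊m/q⌋. -/
lemma le_two_mul_mul_card_mod_eq {m q : ℕ} (hq : 0 < q) (hqm : q ≤ m) (c : Fin q) :
    m ≤ 2 * q * #{a : Fin m | (⟨a % q, Nat.mod_lt _ hq⟩ : Fin q) = c} := by
  have hlt : ∀ s ∈ range (m / q), q * s + c < m := by
    intro s hs
    have h1 : q * (s + 1) ≤ q * (m / q) := Nat.mul_le_mul_left _ (mem_range.1 hs)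
    have h2 := Nat.mul_div_le m q
    have := c.2
    rw [mul_add] at h1
    omega
  have hcard : m / q ≤ #{a : Fin m | (⟨a % q, Nat.mod_lt _ hq⟩ : Fin q) = c} := by
    rw [← card_range (m / q), ← card_attach]
    refine card_le_card_of_injOn (fun s => ⟨q * s + c, hlt s s.2⟩) ?_ ?_
    · intro s _
      simp [Nat.mod_eq_of_lt c.2]
    · intro s _ s' _ hss
      have : q * (s : ℕ) + c = q * s' + c := by simpa using hss
      exact Subtype.ext (Nat.eq_of_mul_eq_mul_left hq (by omega))
  have h1 : 1 ≤ m / q := (Nat.one_le_div_iff hq).2 hqm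
  have h2 : m < q * (m / q + 1) := Nat.lt_mul_div_succ m hq
  calc m ≤ q * (m / q + 1) := h2.le
    _ ≤ q * (2 * (m / q)) := by gcongr; omega
    _ = 2 * q * (m / q) := by ring
    _ ≤ _ := by gcongr

/-- The real indicator function of a code. -/
def Finset.realIndicator {X : Type*} [DecidableEq X] (F : Finset X) (x : X) : ℝ :=
  if x ∈ F then 1 else 0

lemma Finset.realIndicator_eq_zero_or_one {X : Type*} [DecidableEq X] (F : Finset X) (x : X) :
    F.realIndicator x = 0 ∨ F.realIndicator x = 1 := by
  unfold realIndicator; split_ifs <;> simp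

/-! ### From small first level weight to realisations. -/

namespace Configuration

open ProductSpace

variable {ℓ h : ℕ}

/-- If prescribing the coordinates in `T j` of the `j`-th vector is consistent with the
configuration and the restricted codes have little weight on the first level, then there is a
realisation with these prescribed coordinates. -/
lemma exists_isRealisedBy_of_levelOne_le (H : Configuration ℓ h) {m n t q : ℕ}
    (hq : q = h + h * t + 1) (hqm : 4 * q ≤ m) (F : Finset (Fin n → Fin m)) (Φ : Fin ℓ ↪ Fin n)
    (T : Fin h → Finset (Fin n)) (y : Fin h → Fin n → Fin m) (hT : ∀ j, #(T j) ≤ t)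
    (hcons : ∀ j j', j ≠ j' → ∀ i, (i ∈ T j ∧ i ∈ T j' ∧ y j i = y j' i) ↔
      ∃ k, i = Φ k ∧ H.edge j k = H.edge j' k)
    (hf : ∀ j, 4 * q / m * levelOne (pin F.realIndicator (T j) (y j))
      + (4 * q / m) ^ 2 * 𝔼 x, pin F.realIndicator (T j) (y j) x
      < (𝔼 x, pin F.realIndicator (T j) (y j) x) ^ 2 / (h * q + 1)) :
    ∃ x : Fin h → Fin n → Fin m, (∀ j, x j ∈ F) ∧ (∀ j, ∀ i ∈ T j, x j i = y j i) ∧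
      ∀ j j', j ≠ j' → ∀ i, x j i = x j' i ↔ ∃ k, i = Φ k ∧ H.edge j k = H.edge j' k := by
  have hq0 : 0 < q := by omega
  have : Nontrivial (Fin m) := Fin.nontrivial_iff_two_le.2 (by omega)
  set col : Fin m → Fin q := fun a => ⟨a % q, Nat.mod_lt _ hq0⟩
  have hsq : ∀ j, 𝔼 x, pin F.realIndicator (T j) (y j) x ^ 2
      = 𝔼 x, pin F.realIndicator (T j) (y j) x := fun j =>
    expect_congr rfl fun x _ => by
      rcases F.realIndicator_eq_zero_or_one ((T j).piecewise (y j) x) with h | h <;>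
        simp [pin, h]
  obtain ⟨π, hπ⟩ := exists_perm_forall_exists (h := h) col
    (fun c => by rw [Fintype.card_fin]; exact le_two_mul_mul_card_mod_eq hq0 (by omega) c)
    (by simpa using hqm) (fun j => pin F.realIndicator (T j) (y j))
    (fun j => by simpa only [hsq, Fintype.card_fin] using hf j)
  choose w hw hwc using hπ
  -- Colours of prescribed values are set aside. At least h of the q colours remain, a private one
  -- for each edge, so a free value differs from every prescribed value and from the free values of
  -- other edges.
  set used : Finset (Fin q) := univ.biUnion fun j => (T j).image fun i => col (π i (y j i))
  have hused : #used ≤ h * t := by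
    refine card_biUnion_le.trans ?_
    refine (sum_le_sum fun j _ => card_image_le.trans (hT j)).trans_eq ?_
    simp
  have hcard : Fintype.card (Fin h) ≤ Fintype.card {c // c ∈ usedᶜ} := by
    rw [Fintype.card_coe, card_compl, Fintype.card_fin, Fintype.card_fin]
    omega
  obtain ⟨e⟩ := Function.Embedding.nonempty_of_card_le hcard
  set x : Fin h → Fin n → Fin m := fun j => (T j).piecewise (y j) (w j (e j))
  have hin : ∀ j, ∀ i ∈ T j, x j i = y j i := fun j i hi => by simp [x, hi]
  have hout : ∀ j, ∀ i ∉ T j, col (π i (x j i)) = e j := fun j i hi => by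
    simp only [x, piecewise, hi, if_false, hwc]
  have hne : ∀ j j', ∀ i ∈ T j, i ∉ T j' → x j i ≠ x j' i := by
    intro j j' i hi hi' heq
    have h1 := hout j' i hi'
    rw [← heq, hin j i hi] at h1
    refine mem_compl.1 (e j').2 ?_
    rw [← h1]
    exact mem_biUnion.2 ⟨j, mem_univ _, mem_image.2 ⟨i, hi, rfl⟩⟩
  refine ⟨x, fun j => ?_, hin, fun j j' hjj i => ?_⟩
  · by_contra hx
    exact hw j (e j) (if_neg hx)
  · rw [← hcons j j' hjj i]
    by_cases hi : i ∈ T j <;> by_cases hi' : i ∈ T j'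
    · simp [hi, hi', hin]
    · simpa [hi, hi'] using hne j j' i hi hi'
    · simpa [hi, hi'] using (hne j' j i hi' hi).symm
    · simp only [hi, false_and, iff_false]
      intro heq
      have h1 := hout j i hi
      rw [heq, hout j' i hi'] at h1
      exact hjj (e.injective (Subtype.ext h1.symm))

/-- The parts in which the `j`-th edge shares its vertex with another edge. -/
noncomputable def sharedParts (H : Configuration ℓ h) (j : Fin h) : Finset (Fin ℓ) := by
  classical exact {k | ∃ j', j' ≠ j ∧ H.edge j k = H.edge j' k}

lemma mem_sharedParts {H : Configuration ℓ h} {j : Fin h} {k : Fin ℓ} :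
    k ∈ H.sharedParts j ↔ ∃ j', j' ≠ j ∧ H.edge j k = H.edge j' k := by
  simp [sharedParts]

lemma IsFlat.edge_eq {H : Configuration ℓ h} (hflat : H.IsFlat) {j j' : Fin h} {k : Fin ℓ}
    (hj : k ∈ H.sharedParts j) (hj' : k ∈ H.sharedParts j') : H.edge j k = H.edge j' k := by
  obtain ⟨i, hi, he⟩ := mem_sharedParts.1 hj
  obtain ⟨i', hi', he'⟩ := mem_sharedParts.1 hj'
  exact hflat k _ _ ⟨j, i, hi.symm, rfl, he.symm⟩ ⟨j', i', hi'.symm, rfl, he'.symm⟩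

end Configuration

/-! ### Coordinates of small influence and good restrictions. -/

namespace ProductSpace

/-- All but few coordinates have small influence on the low levels, so that one can find
coordinates outside a given set that meet only little of the weight. -/
lemma exists_embedding_influence_le {θ : ℝ} (hθ : 0 < θ) (ℓ d : ℕ) :
    ∃ C : ℕ, ∀ n, C ≤ n → ∀ (w : Finset (Fin n) → ℝ) (J : Finset (Fin n)), (∀ S, 0 ≤ w S) →
      #J ≤ d → ∃ Φ : Fin ℓ ↪ Fin n, (∀ k, Φ k ∉ J) ∧ ∀ T : Finset (Fin n),
        (∀ i ∈ T, ∃ k, i = Φ k) → ∑ S with #S ≤ d ∧ (S ∩ T).Nonempty, w S ≤ θ * ∑ S, w S := by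
  obtain ⟨C, hC⟩ := exists_nat_gt (ℓ + d + (ℓ + 1) * d / θ)
  refine ⟨C, fun n hn w J hw hJ => ?_⟩
  set total := ∑ S, w S
  have htotal : 0 ≤ total := sum_nonneg fun S _ => hw S
  set I : Fin n → ℝ := fun i => ∑ S with #S ≤ d ∧ i ∈ S, w S
  have hI0 : ∀ i, 0 ≤ I i := fun i => sum_nonneg fun S _ => hw S
  have hI : ∀ i, I i = ∑ S with #S ≤ d, if i ∈ S then w S else 0 := fun i => by
    rw [← sum_filter, filter_filter]
  have hIsum : ∑ i, I i ≤ d * total := by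
    have h1 : ∑ i, I i = ∑ S with #S ≤ d, #S * w S := by
      simp only [hI]
      rw [sum_comm]
      refine sum_congr rfl fun S _ => ?_
      simp
    rw [h1, mul_sum]
    refine (sum_le_sum fun S hS => mul_le_mul_of_nonneg_right
      (Nat.cast_le.2 (mem_filter.1 hS).2) (hw S)).trans ?_
    exact sum_le_sum_of_subset_of_nonneg (filter_subset _ _)
      fun S _ _ => mul_nonneg (Nat.cast_nonneg _) (hw S)
  -- The influences sum to at most d times the total weight, so a bounded number of coordinates
  -- exceed the share θ/(ℓ + 1) allotted to each of the ℓ chosen ones.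
  set bad : Finset (Fin n) := {i | θ * total < (ℓ + 1) * I i}
  have hbad : (#bad : ℝ) ≤ (ℓ + 1) * d / θ := by
    rcases htotal.eq_or_lt with h0 | hpos
    · have : bad = ∅ := by
        ext i
        have h1 : I i ≤ ∑ i, I i := single_le_sum (fun i _ => hI0 i) (mem_univ i)
        have h2 : I i = 0 := le_antisymm (by rw [← h0] at hIsum; linarith) (hI0 i)
        simp [bad, h2, ← h0]
      rw [this]; simp; positivity
    · rw [le_div_iff₀ hθ]
      refine le_of_mul_le_mul_right ?_ hpos
      calc #bad * θ * total = ∑ i ∈ bad, θ * total := by simp; ring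
        _ ≤ ∑ i ∈ bad, (ℓ + 1) * I i := sum_le_sum fun i hi => (mem_filter.1 hi).2.le
        _ ≤ ∑ i, (ℓ + 1) * I i := sum_le_sum_of_subset_of_nonneg (subset_univ _)
            fun i _ _ => mul_nonneg (by positivity) (hI0 i)
        _ = (ℓ + 1) * ∑ i, I i := by rw [mul_sum]
        _ ≤ (ℓ + 1) * (d * total) := by gcongr
        _ = _ := by ring
  have hcard : Fintype.card (Fin ℓ) ≤ Fintype.card {i // i ∈ (bad ∪ J)ᶜ} := by
    rw [Fintype.card_coe, card_compl, Fintype.card_fin, Fintype.card_fin]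
    have h1 : (#(bad ∪ J) : ℝ) ≤ #bad + #J := by exact_mod_cast card_union_le bad J
    have h2 : (#J : ℝ) ≤ d := by exact_mod_cast hJ
    have h3 : (C : ℝ) ≤ n := by exact_mod_cast hn
    have h4 : ((ℓ + #(bad ∪ J) : ℕ) : ℝ) ≤ n := by push_cast; linarith
    have h5 : ℓ + #(bad ∪ J) ≤ n := by exact_mod_cast h4
    omega
  obtain ⟨e⟩ := Function.Embedding.nonempty_of_card_le hcard
  refine ⟨e.trans (Function.Embedding.subtype _), fun k hk => ?_, fun T hT => ?_⟩
  · exact mem_compl.1 (e k).2 (mem_union_right _ hk)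
  · have hk : ∀ k, I (e k) ≤ θ * total / (ℓ + 1) := by
      intro k
      have h1 : (e k : Fin n) ∉ bad := fun hk => mem_compl.1 (e k).2 (mem_union_left _ hk)
      rw [le_div_iff₀ (by positivity), mul_comm]
      simpa [bad] using h1
    calc ∑ S with #S ≤ d ∧ (S ∩ T).Nonempty, w S
        = ∑ S with #S ≤ d, if (S ∩ T).Nonempty then w S else 0 := by
          rw [← sum_filter, filter_filter]
      _ ≤ ∑ S with #S ≤ d, ∑ k, if (e k : Fin n) ∈ S then w S else 0 := by
          refine sum_le_sum fun S _ => ?_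
          have hnn : ∀ k ∈ (univ : Finset (Fin ℓ)), 0 ≤ if (e k : Fin n) ∈ S then w S else 0 :=
            fun k _ => by split_ifs <;> simp [hw]
          split_ifs with hne
          · obtain ⟨i, hi⟩ := hne
            obtain ⟨k, rfl⟩ := hT i (mem_inter.1 hi).2
            have hm : (e k : Fin n) ∈ S := (mem_inter.1 hi).1
            simpa [hm] using single_le_sum hnn (mem_univ k)
          · exact sum_nonneg hnn
      _ = ∑ k, I (e k) := by rw [sum_comm]; simp only [hI]
      _ ≤ ∑ _k : Fin ℓ, θ * total / (ℓ + 1) := sum_le_sum fun k _ => hk k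
      _ = θ * total * (ℓ / (ℓ + 1)) := by simp; ring
      _ ≤ θ * total * 1 := by
          gcongr
          rw [div_le_one (by positivity)]; linarith
      _ = _ := mul_one _

section

variable {ι α : Type*} [Fintype ι] [DecidableEq ι] [Fintype α] [DecidableEq α]

lemma pin_piecewise (f : (ι → α) → ℝ) (T : Finset ι) (x y : ι → α) :
    pin f T (T.piecewise y x) = pin f T y := by
  ext z
  simp only [pin]
  congr 1
  ext i
  by_cases hi : i ∈ T <;> simp [hi]

/-- Chebyshev's inequality for the density of a random restriction. -/
lemma expect_pin_lt_mul_le [Nonempty α] (f : (ι → α) → ℝ) (T : Finset ι) {a : ℝ}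
    (ha : a ≤ 𝔼 x, f x) :
    (𝔼 y, if 𝔼 x, pin f T y x < a then (1 : ℝ) else 0) * ((𝔼 x, f x) - a) ^ 2
      ≤ ∑ S with S ⊆ T ∧ S.Nonempty, weight f S := by
  set μ := 𝔼 x, f x
  have h1 : 𝔼 y, (𝔼 x, pin f T y x) = μ := expect_piecewise T f
  have h2 : 𝔼 y, ((𝔼 x, pin f T y x) - μ) ^ 2 = condEnergy f T - μ ^ 2 := by
    have : ∀ y, ((𝔼 x, pin f T y x) - μ) ^ 2
        = (𝔼 x, pin f T y x) ^ 2 - 2 * μ * (𝔼 x, pin f T y x) + μ ^ 2 := fun y => by ring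
    simp only [this, expect_add_distrib, expect_sub_distrib, ← mul_expect, h1,
      Fintype.expect_const, condEnergy_eq_expect_sq]
    ring
  have h3 : condEnergy f T - μ ^ 2 = ∑ S with S ⊆ T ∧ S.Nonempty, weight f S := by
    rw [condEnergy_eq_sum_weight, ← weight_empty, sub_eq_iff_eq_add,
      ← sum_erase_add _ _ (empty_mem_powerset T)]
    congr 2
    ext S
    simp [nonempty_iff_ne_empty, and_comm]
  rw [← h3, ← h2, expect_mul]
  refine expect_le_expect fun y _ => ?_
  split_ifs with h
  · rw [one_mul]
    nlinarith
  · rw [zero_mul]; exact sq_nonneg _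

/-- For a point drawn from the code itself, a restriction of low density is unlikely because such
restrictions hold little of the code. Unlike Chebyshev, this works at densities of order 1/m. -/
lemma expect_mul_pin_lt_le [Nonempty α] {f : (ι → α) → ℝ} (T : Finset ι) {a : ℝ} (ha : 0 ≤ a) :
    𝔼 y, f y * (if 𝔼 x, pin f T y x < a then (1 : ℝ) else 0) ≤ a := by
  rw [expect_mul_expect_pin f _ T fun x y => by simp only [pin_piecewise]]
  refine expect_le univ_nonempty fun y _ => ?_
  split_ifs with h
  · rw [mul_one]; exact h.le
  · rw [mul_zero]; exact ha

/-- Markov's inequality for the first level weight of a restriction relative to its density, with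
the restriction chosen by a point of the code. -/
lemma expect_mul_pin_levelOne_le [Nonempty α] {f : (ι → α) → ℝ} (T : Finset ι) {c : ℝ} :
    c * 𝔼 y, f y * (if c * 𝔼 x, pin f T y x < levelOne (pin f T y) then (1 : ℝ) else 0)
      ≤ 𝔼 y, levelOne (pin f T y) := by
  rw [expect_mul_expect_pin f _ T fun x y => by simp only [pin_piecewise], mul_expect]
  refine expect_le_expect fun y _ => ?_
  split_ifs with h
  · rw [mul_one]; exact h.le
  · rw [mul_zero, mul_zero]; exact levelOne_nonneg _

end

end ProductSpace

/-! ### The dense and the sparse case. -/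

namespace Configuration

open ProductSpace

variable {ℓ h : ℕ}

/-- A code that is dense in some codimension one subcubes contains a realisation of a flat
configuration with prescribed incidences to these subcubes. -/
lemma IsFlat.exists_isRealisedBy_of_dense {H : Configuration ℓ h} (hflat : H.IsFlat) {ε : ℝ}
    (hε : 0 < ε) : ∃ C : ℕ, ∀ m n, C ≤ m → C ≤ n → ∀ (F : Finset (Fin n → Fin m))
      (d : Fin h → Fin n × Fin m) (A : Set (Fin ℓ)) (Φ₀ : Fin ℓ ↪ Fin n),
      (∀ k ∈ A, ∀ j j', j ≠ j' → H.edge j k = H.edge j' k → d j = d j' ∧ (d j).1 = Φ₀ k) →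
      (∀ j j', j ≠ j' → d j = d j' → ∃ k ∈ A, H.edge j k = H.edge j' k) →
      (∀ j, ε ≤ 𝔼 x, F.realIndicator x * diag (x (d j).1) (d j).2) →
      ∃ x : Fin h → Fin n → Fin m, (∀ j, x j ∈ F) ∧ H.IsRealisedBy x ∧
        (∀ j, x j (d j).1 = (d j).2) ∧ ∀ j j', x j (d j').1 = (d j').2 → d j = d j' := by
  classical
  obtain ⟨q, hq⟩ : ∃ q, q = h + h * (ℓ + 1) + 1 := ⟨_, rfl⟩
  -- The total weight of the h functions is at most h, so Chebyshev at deviation ε/2 fails with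
  -- probability at most h/(h + 1)² for each edge, and h such failures sum to less than 1.
  set θ : ℝ := ε ^ 2 / (4 * (h + 1) ^ 2) with hθdef
  have hθ : 0 < θ := by positivity
  obtain ⟨C₁, hC₁⟩ := exists_embedding_influence_le hθ ℓ (h + ℓ)
  obtain ⟨C₂, hC₂⟩ := exists_nat_gt (32 * q * (h * q + 1) / ε ^ 2)
  refine ⟨C₁ + C₂ + 4 * q, fun m n hm hn F d A Φ₀ hA hd hdens => ?_⟩
  have hm0 : 0 < m := by omega
  have : NeZero m := ⟨hm0.ne'⟩
  set f : Fin h → (Fin n → Fin m) → ℝ :=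
    fun j => pin F.realIndicator {(d j).1} (fun _ => (d j).2) with hfdef
  have hf01 : ∀ j x, f j x = 0 ∨ f j x = 1 := fun j x => F.realIndicator_eq_zero_or_one _
  have hfμ : ∀ j, ε ≤ 𝔼 x, f j x := by
    intro j
    refine (hdens j).trans_eq ?_
    simp only [hfdef, pin]
    rw [expect_piecewise_eq]
    simp
  have hf1 : ∀ j, 𝔼 x, f j x ≤ 1 := fun j => expect_le univ_nonempty fun x _ => by
    rcases hf01 j x with h | h <;> simp [h]
  -- Avoiding the range of `Φ₀` as well keeps the map glued from `Φ₀` on `A` and `Ψ` elsewhere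
  -- injective.
  set J : Finset (Fin n) := univ.image (fun j => (d j).1) ∪ univ.image Φ₀
  have hJ : #J ≤ h + ℓ := by
    refine (card_union_le _ _).trans (add_le_add ?_ ?_) <;>
      exact card_image_le.trans (by simp)
  have hdJ : ∀ j, (d j).1 ∈ J := fun j => mem_union_left _ (mem_image_of_mem _ (mem_univ j))
  have hΦ₀J : ∀ k, Φ₀ k ∈ J := fun k => mem_union_right _ (mem_image_of_mem _ (mem_univ k))
  obtain ⟨Ψ, hΨJ, hΨ⟩ := hC₁ n (by omega) (fun S => ∑ j, weight (f j) S) J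
    (fun S => sum_nonneg fun j _ => weight_nonneg _ _) hJ
  -- Agreements in parts of `A` happen at the fixed coordinates of the subcubes; the other shared
  -- parts need fresh coordinates.
  set K : Fin h → Finset (Fin ℓ) := fun j => {k ∈ H.sharedParts j | k ∉ A}
  set T : Fin h → Finset (Fin n) := fun j => (K j).map Ψ
  have hTcard : ∀ j, #(T j) ≤ ℓ := fun j => by
    simpa [T] using card_le_univ (K j)
  have hdT : ∀ j j', (d j).1 ∉ T j' := by
    intro j j' hj
    obtain ⟨k, -, hk⟩ := mem_map.1 hj
    exact hΨJ k (hk ▸ hdJ j)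
  have hweight : ∀ j, ∑ S with S ⊆ T j ∧ S.Nonempty, weight (f j) S ≤ θ * h := by
    intro j
    have h1 := hΨ (T j) fun i hi => by
      obtain ⟨k, -, hk⟩ := mem_map.1 hi
      exact ⟨k, hk.symm⟩
    have h2 : ∑ S, ∑ j, weight (f j) S ≤ h := by
      rw [sum_comm]
      refine (sum_le_sum fun j _ => (sum_weight_eq_expect (f j) (hf01 j)).trans_le
        (hf1 j)).trans_eq ?_
      simp
    calc ∑ S with S ⊆ T j ∧ S.Nonempty, weight (f j) S
        ≤ ∑ S with #S ≤ h + ℓ ∧ (S ∩ T j).Nonempty, weight (f j) S := by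
          refine sum_le_sum_of_subset_of_nonneg ?_ fun S _ _ => weight_nonneg _ _
          intro S hS
          simp only [mem_filter, mem_univ, true_and] at hS ⊢
          refine ⟨(card_le_card hS.1).trans ((hTcard j).trans (by omega)), ?_⟩
          rw [inter_eq_left.2 hS.1]
          exact hS.2
      _ ≤ ∑ S with #S ≤ h + ℓ ∧ (S ∩ T j).Nonempty, ∑ j, weight (f j) S :=
          sum_le_sum fun S _ => single_le_sum (f := fun j => weight (f j) S)
            (fun j _ => weight_nonneg _ _) (mem_univ j)
      _ ≤ _ := h1.trans (by gcongr)
  have hbad : ∀ j, (𝔼 y, if 𝔼 x, pin (f j) (T j) y x < ε / 2 then (1 : ℝ) else 0)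
      ≤ h / (h + 1) ^ 2 := by
    intro j
    have h1 := expect_pin_lt_mul_le (f j) (T j) (a := ε / 2) (by linarith [hfμ j])
    have h2 : (ε / 2) ^ 2 ≤ ((𝔼 x, f j x) - ε / 2) ^ 2 := by
      have := hfμ j
      gcongr
      linarith
    have h0 : 0 ≤ 𝔼 y, if 𝔼 x, pin (f j) (T j) y x < ε / 2 then (1 : ℝ) else 0 :=
      expect_nonneg fun _ _ => by split_ifs <;> norm_num
    have h3 := (mul_le_mul_of_nonneg_left h2 h0).trans (h1.trans (hweight j))
    have h4 : θ * h = h / (h + 1) ^ 2 * (ε / 2) ^ 2 := by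
      rw [hθdef]; field_simp; ring
    rw [h4] at h3
    exact le_of_mul_le_mul_right h3 (by positivity)
  have hsum : 𝔼 y, ∑ j, (if 𝔼 x, pin (f j) (T j) y x < ε / 2 then (1 : ℝ) else 0) < 1 := by
    rw [expect_sum_comm]
    refine (sum_le_sum fun j _ => hbad j).trans_lt ?_
    simp only [sum_const, card_univ, Fintype.card_fin, nsmul_eq_mul]
    rw [mul_div_assoc', div_lt_one (by positivity)]
    nlinarith [(Nat.cast_nonneg h : (0 : ℝ) ≤ h)]
  obtain ⟨y, -, hy⟩ := exists_lt_of_expect_lt univ_nonempty hsum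
  have hyμ : ∀ j, ε / 2 ≤ 𝔼 x, pin (f j) (T j) y x := by
    intro j
    by_contra! hlt
    have h1 := single_le_sum (f := fun j => if 𝔼 x, pin (f j) (T j) y x < ε / 2
      then (1 : ℝ) else 0) (fun j _ => by split_ifs <;> norm_num) (mem_univ j)
    simp only [hlt, if_true] at h1
    linarith
  set Y : Fin h → Fin n → Fin m := fun j => Function.update y (d j).1 (d j).2
  have hpin : ∀ j, pin F.realIndicator (insert (d j).1 (T j)) (Y j) = pin (f j) (T j) y := by
    intro j
    ext x
    simp only [hfdef, pin]
    congr 1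
    ext i
    by_cases hi : i = (d j).1
    · subst hi; simp [Y]
    · by_cases hiT : i ∈ T j <;> simp [hi, hiT, Y]
  have hΦinj : Function.Injective fun k => if k ∈ A then Φ₀ k else Ψ k := by
    intro k k' hkk
    simp only at hkk
    split_ifs at hkk with h1 h2 h2
    · exact Φ₀.injective hkk
    · exact absurd (hkk ▸ hΦ₀J k) (hΨJ k')
    · exact absurd (hkk ▸ hΦ₀J k') (hΨJ k)
    · exact Ψ.injective hkk
  set Φ : Fin ℓ ↪ Fin n := ⟨_, hΦinj⟩
  have hΦA : ∀ k ∈ A, Φ k = Φ₀ k := fun k hk => if_pos hk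
  have hΦA' : ∀ k ∉ A, Φ k = Ψ k := fun k hk => if_neg hk
  have hcons : ∀ j j', j ≠ j' → ∀ i, (i ∈ insert (d j).1 (T j) ∧ i ∈ insert (d j').1 (T j') ∧
      Y j i = Y j' i) ↔ ∃ k, i = Φ k ∧ H.edge j k = H.edge j' k := by
    intro j j' hjj i
    constructor
    · rintro ⟨h1, h2, h3⟩
      rcases mem_insert.1 h1 with rfl | h1
      · have h4 : (d j).1 = (d j').1 := (mem_insert.1 h2).resolve_right (hdT _ _)
        have h5 : d j = d j' := by
          refine Prod.ext h4 ?_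
          simp only [Y, Function.update_self] at h3
          rw [h3, h4, Function.update_self]
        obtain ⟨k, hkA, hk⟩ := hd j j' hjj h5
        exact ⟨k, by rw [hΦA k hkA]; exact (hA k hkA j j' hjj hk).2, hk⟩
      · have h2 : i ∈ T j' := (mem_insert.1 h2).resolve_left fun h => hdT j' j (h ▸ h1)
        obtain ⟨k, hk, rfl⟩ := mem_map.1 h1
        have hk' : k ∈ K j' := by simpa [T] using h2
        rw [mem_filter] at hk hk'
        exact ⟨k, (hΦA' k hk.2).symm, hflat.edge_eq hk.1 hk'.1⟩
    · rintro ⟨k, rfl, hk⟩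
      by_cases hkA : k ∈ A
      · obtain ⟨h1, h2⟩ := hA k hkA j j' hjj hk
        have h3 : Φ k = (d j).1 := by rw [hΦA k hkA, h2]
        rw [h3]
        refine ⟨mem_insert_self _ _, by rw [h1]; exact mem_insert_self _ _, ?_⟩
        simp [Y, h1]
      · have hj : k ∈ H.sharedParts j := mem_sharedParts.2 ⟨j', hjj.symm, hk⟩
        have hj' : k ∈ H.sharedParts j' := mem_sharedParts.2 ⟨j, hjj, hk.symm⟩
        rw [hΦA' k hkA]
        refine ⟨mem_insert_of_mem (mem_map_of_mem _ (mem_filter.2 ⟨hj, hkA⟩)),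
          mem_insert_of_mem (mem_map_of_mem _ (mem_filter.2 ⟨hj', hkA⟩)), ?_⟩
        have h1 : ∀ j, Ψ k ≠ (d j).1 := fun j he => hΨJ k (he ▸ hdJ j)
        simp [Y, h1]
  have hmR : (32 * q * (h * q + 1) / ε ^ 2 : ℝ) < m :=
    hC₂.trans_le (by exact_mod_cast (by omega : C₂ ≤ m))
  have hmpos : (0 : ℝ) < m := by exact_mod_cast hm0
  have hc1 : (4 * q / m : ℝ) ≤ 1 := by
    rw [div_le_one hmpos]
    exact_mod_cast (by omega : 4 * q ≤ m)
  obtain ⟨x, hxF, hxY, hx⟩ := H.exists_isRealisedBy_of_levelOne_le hq (by omega) F Φ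
    (fun j => insert (d j).1 (T j)) Y
    (fun j => (card_insert_le _ _).trans (by simpa using hTcard j)) hcons fun j => by
      rw [hpin j]
      have h01 : ∀ x, pin (f j) (T j) y x = 0 ∨ pin (f j) (T j) y x = 1 := fun x => hf01 j _
      have hle : 𝔼 x, pin (f j) (T j) y x ≤ 1 := expect_le univ_nonempty fun x _ => by
        rcases h01 x with h | h <;> simp [h]
      have hl := levelOne_le _ h01
      -- The density is bounded below independently of m, so bounding the first level weight by 1 is
      -- enough.
      calc _ ≤ (4 * q / m * 1 + 4 * q / m * 1 : ℝ) := by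
            gcongr
            · exact hl.trans hle
            · exact expect_nonneg fun x _ => by rcases h01 x with h | h <;> simp [h]
            · rw [sq]; exact mul_le_of_le_one_left (by positivity) hc1
        _ < (ε / 2) ^ 2 / (h * q + 1) := by
            rw [lt_div_iff₀ (by positivity)]
            rw [div_lt_iff₀ (by positivity)] at hmR
            have : (4 * q / m * 1 + 4 * q / m * 1 : ℝ) * (h * q + 1)
                = (32 * q * (h * q + 1)) / m / 4 := by ring
            rw [this, div_lt_iff₀ (by norm_num), div_lt_iff₀ hmpos]
            linarith
        _ ≤ _ := by
            have := hyμ j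
            gcongr
  have hxd : ∀ j, x j (d j).1 = (d j).2 := fun j => by
    rw [hxY j _ (mem_insert_self _ _)]; simp [Y]
  refine ⟨x, hxF, ⟨Φ, hx⟩, hxd, fun j j' hjj => ?_⟩
  by_contra hne
  have hne' : j ≠ j' := fun h => hne (h ▸ rfl)
  obtain ⟨k, hk, hke⟩ := (hx j j' hne' _).1 (hjj.trans (hxd j').symm)
  by_cases hkA : k ∈ A
  · exact hne (hA k hkA j j' hne' hke).1
  · rw [hΦA' k hkA] at hk
    exact hΨJ k (hk ▸ hdJ j')

/-- A sparse code that is not dense in any codimension one subcube contains a realisation of any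
given flat configuration. -/
lemma IsFlat.exists_isRealisedBy_of_sparse {H : Configuration ℓ h} (hflat : H.IsFlat) {η : ℝ}
    (hη : 0 < η) : ∃ ε : ℝ, 0 < ε ∧ ∃ C : ℕ, ∀ m n, C ≤ m → C ≤ n →
      ∀ F : Finset (Fin n → Fin m), η / m ≤ 𝔼 x, F.realIndicator x →
      𝔼 x, F.realIndicator x ≤ ε → (∀ i a, 𝔼 x, F.realIndicator x * diag (x i) a ≤ ε) →
      ∃ x : Fin h → Fin n → Fin m, (∀ j, x j ∈ F) ∧ H.IsRealisedBy x := by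
  classical
  obtain ⟨q, hq⟩ : ∃ q, q = h + h * ℓ + 1 := ⟨_, rfl⟩
  have hq0 : (0 : ℝ) < q := by exact_mod_cast (by omega : 0 < q)
  -- Two bad events for each of h edges, each of probability at most c: 2ch < 1.
  set c : ℝ := 1 / (4 * (h + 1)) with hcdef
  have hc : 0 < c := by positivity
  -- Chosen so that the first level uses half of the admissible variance; `C₂` leaves the other half
  -- to the higher levels.
  set γ' : ℝ := c * η / (8 * q * (h * q + 1)) with hγ'def
  have hγ' : 0 < γ' := by positivity
  set γ : ℝ := min 1 (γ' / (8 * (h + 1)))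
  have hγ : 0 < γ := lt_min one_pos (by positivity)
  -- One γ is for the first level weight of `F`, the other for the low-degree weight meeting the
  -- prescribed coordinates.
  have hγγ' : 2 * γ ≤ γ' * c := by
    have h1 : γ ≤ γ' / (8 * (h + 1)) := min_le_right _ _
    have h2 : γ' * c = 2 * (γ' / (8 * (h + 1))) := by rw [hcdef]; field_simp; ring
    linarith
  obtain ⟨C₁, hC₁⟩ := exists_embedding_influence_le hγ ℓ (ℓ + 1)
  obtain ⟨C₂, hC₂⟩ := exists_nat_gt (32 * q ^ 2 * (h * q + 1) / (c * η))
  refine ⟨γ ^ 3 / 4, by positivity, C₁ + C₂ + 4 * q, fun m n hm hn F hFη hFε hFd => ?_⟩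
  have hm0 : 0 < m := by omega
  have : NeZero m := ⟨hm0.ne'⟩
  have hmpos : (0 : ℝ) < m := by exact_mod_cast hm0
  set f : (Fin n → Fin m) → ℝ := F.realIndicator
  have hf01 : ∀ x, f x = 0 ∨ f x = 1 := F.realIndicator_eq_zero_or_one
  have hW := levelOne_le_mul hγ (min_le_left _ _) f hf01 hFε hFd
  set μ := 𝔼 x, f x
  have hμpos : 0 < μ := (div_pos hη hmpos).trans_le hFη
  obtain ⟨Φ, -, hΦ⟩ := hC₁ n (by omega) (weight f) ∅ (weight_nonneg f) (by simp)
  rw [sum_weight_eq_expect f hf01] at hΦ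
  set T : Fin h → Finset (Fin n) := fun j => (H.sharedParts j).map Φ
  have hTcard : ∀ j, #(T j) ≤ ℓ := fun j => by
    simpa [T] using card_le_univ (H.sharedParts j)
  have hlevel : ∀ j, 𝔼 y, levelOne (pin f (T j) y) ≤ γ' * (c * μ) := by
    intro j
    have h1 : ∑ S with #S ≤ #(T j) + 1 ∧ (S ∩ T j).Nonempty, weight f S ≤ γ * μ := by
      refine le_trans (sum_le_sum_of_subset_of_nonneg ?_ fun S _ _ => weight_nonneg f S)
        (hΦ (T j) fun i hi => ?_)
      · intro S hS
        simp only [mem_filter, mem_univ, true_and] at hS ⊢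
        exact ⟨hS.1.trans (by have := hTcard j; omega), hS.2⟩
      · obtain ⟨k, -, hk⟩ := mem_map.1 hi
        exact ⟨k, hk.symm⟩
    have h2 := expect_levelOne_pin f (T j)
    have h3 := mul_le_mul_of_nonneg_right hγγ' hμpos.le
    linarith
  set bad₁ : Fin h → (Fin n → Fin m) → ℝ := fun j y =>
    if 𝔼 x, pin f (T j) y x < c * μ then 1 else 0
  set bad₂ : Fin h → (Fin n → Fin m) → ℝ := fun j y =>
    if γ' * 𝔼 x, pin f (T j) y x < levelOne (pin f (T j) y) then 1 else 0
  have hb₁0 : ∀ j y, 0 ≤ bad₁ j y := fun j y => by simp only [bad₁]; split_ifs <;> norm_num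
  have hb₂0 : ∀ j y, 0 ≤ bad₂ j y := fun j y => by simp only [bad₂]; split_ifs <;> norm_num
  have hb₁ : ∀ j, 𝔼 y, f y * bad₁ j y ≤ c * μ := fun j =>
    expect_mul_pin_lt_le (T j) (by positivity)
  have hb₂ : ∀ j, 𝔼 y, f y * bad₂ j y ≤ c * μ := fun j =>
    le_of_mul_le_mul_left ((expect_mul_pin_levelOne_le (T j)).trans (hlevel j)) hγ'
  have hsum : 𝔼 y, f y * ∑ j, (bad₁ j y + bad₂ j y) < 𝔼 y, f y := by
    simp only [mul_sum, mul_add, expect_sum_comm, expect_add_distrib]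
    refine (sum_le_sum fun j _ => add_le_add (hb₁ j) (hb₂ j)).trans_lt ?_
    have h1 : ∑ _j : Fin h, (c * μ + c * μ) = h / (2 * (h + 1)) * μ := by
      simp only [sum_const, card_univ, Fintype.card_fin, nsmul_eq_mul, hcdef]
      field_simp
      ring
    rw [h1]
    refine mul_lt_of_lt_one_left hμpos ?_
    rw [div_lt_one (by positivity)]
    linarith [(Nat.cast_nonneg h : (0 : ℝ) ≤ h)]
  obtain ⟨y, -, hy⟩ := exists_lt_of_expect_lt_expect hsum
  have hy1 : ∑ j, (bad₁ j y + bad₂ j y) < 1 := by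
    rcases hf01 y with h | h <;> rw [h] at hy <;> linarith
  have hgood : ∀ j, bad₁ j y + bad₂ j y < 1 := fun j =>
    (single_le_sum (f := fun j => bad₁ j y + bad₂ j y)
      (fun j _ => add_nonneg (hb₁0 j y) (hb₂0 j y)) (mem_univ j)).trans_lt hy1
  have hg₁ : ∀ j, c * μ ≤ 𝔼 x, pin f (T j) y x := by
    intro j
    by_contra! hlt
    have h1 : bad₁ j y = 1 := if_pos hlt
    linarith [hgood j, hb₂0 j y]
  have hg₂ : ∀ j, levelOne (pin f (T j) y) ≤ γ' * 𝔼 x, pin f (T j) y x := by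
    intro j
    by_contra! hlt
    have h1 : bad₂ j y = 1 := if_pos hlt
    linarith [hgood j, hb₁0 j y]
  have hcons : ∀ j j', j ≠ j' → ∀ i, (i ∈ T j ∧ i ∈ T j' ∧ y i = y i) ↔
      ∃ k, i = Φ k ∧ H.edge j k = H.edge j' k := by
    intro j j' hjj i
    constructor
    · rintro ⟨h1, h2, -⟩
      obtain ⟨k, hk, rfl⟩ := mem_map.1 h1
      have hk' : k ∈ H.sharedParts j' := by simpa [T] using h2
      exact ⟨k, rfl, hflat.edge_eq hk hk'⟩
    · rintro ⟨k, rfl, hk⟩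
      exact ⟨mem_map_of_mem _ (mem_sharedParts.2 ⟨j', hjj.symm, hk⟩),
        mem_map_of_mem _ (mem_sharedParts.2 ⟨j, hjj, hk.symm⟩), rfl⟩
  have hmR : (32 * q ^ 2 * (h * q + 1) / (c * η) : ℝ) < m :=
    hC₂.trans_le (by exact_mod_cast (by omega : C₂ ≤ m))
  obtain ⟨x, hxF, -, hx⟩ := H.exists_isRealisedBy_of_levelOne_le hq (by omega) F Φ T
    (fun _ => y) hTcard hcons fun j => by
      have h1 : c * (η / m) ≤ 𝔼 x, pin f (T j) y x :=
        (mul_le_mul_of_nonneg_left hFη hc.le).trans (hg₁ j)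
      change 4 * q / m * levelOne (pin f (T j) y) + (4 * q / m) ^ 2 * 𝔼 x, pin f (T j) y x
        < (𝔼 x, pin f (T j) y x) ^ 2 / (h * q + 1)
      have h2 := hg₂ j
      set ν := 𝔼 x, pin f (T j) y x
      have hν : 0 < ν := lt_of_lt_of_le (by positivity) h1
      calc 4 * q / m * levelOne (pin f (T j) y) + (4 * q / m) ^ 2 * ν
          ≤ 4 * q / m * (γ' * ν) + (4 * q / m) ^ 2 * ν := by gcongr
        _ = (4 * q * γ' + 16 * q ^ 2 / m) / m * ν := by field_simp; ring
        _ < c * (η / m) / (h * q + 1) * ν := by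
            refine mul_lt_mul_of_pos_right ?_ hν
            have h3 : 4 * q * γ' = c * η / (h * q + 1) / 2 := by
              rw [hγ'def]; field_simp; ring
            have h4 : (16 * q ^ 2 / m : ℝ) < c * η / (h * q + 1) / 2 := by
              rw [div_lt_iff₀ (by positivity)] at hmR
              rw [div_div, div_lt_div_iff₀ hmpos (by positivity)]
              linarith
            rw [show c * (η / m) / (h * q + 1) = c * η / (h * q + 1) / m by ring]
            refine div_lt_div_of_pos_right ?_ hmpos
            linarith
        _ ≤ ν / (h * q + 1) * ν := by gcongr
        _ = _ := by ring
  exact ⟨x, hxF, Φ, hx⟩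

lemma IsFree.mono {H : Configuration ℓ h} {m n : ℕ} {F G : Finset (Fin n → Fin m)}
    (hG : H.IsFree G) (hFG : F ⊆ G) : H.IsFree F :=
  fun ⟨x, hx, hr⟩ => hG ⟨x, fun j => hFG (hx j), hr⟩

/-- Any `h` subcubes of codimension one contain a copy of a flat configuration of size `h`, so
the crosscut is attained. -/
lemma IsFlat.exists_isCutBy {H : Configuration ℓ h} (hflat : H.IsFlat) :
    ∃ N : ℕ, ∀ m n : ℕ, N ≤ m → N ≤ n →
      ∀ D : Finset (Fin n × Fin m), #D = H.crosscut → H.IsCutBy D := by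
  -- Nonemptiness, witnessed by `h`, ensures that the infimum is attained and is not the default
  -- value 0.
  refine Nat.sInf_mem (s := {s | ∃ N : ℕ, ∀ m n : ℕ, N ≤ m → N ≤ n →
    ∀ D : Finset (Fin n × Fin m), #D = s → H.IsCutBy D}) ⟨h, ?_⟩
  obtain ⟨C, hC⟩ := hflat.exists_isRealisedBy_of_dense one_pos
  refine ⟨C + ℓ + 1, fun m n hm hn D hD => ?_⟩
  have : NeZero m := ⟨by omega⟩
  let e := (D.equivFinOfCardEq hD).symm
  -- The subcubes assigned to the edges are distinct, so no agreement is forced: `A` is empty and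
  -- `Φ₀` arbitrary.
  obtain ⟨x, -, hx, hxe, hinj⟩ := hC m n (by omega) (by omega) univ (fun j => (e j : Fin n × Fin m))
    ∅ (Fin.castLEEmb (by omega)) (by simp)
    (fun j j' hjj he => absurd (e.injective (Subtype.ext he)) hjj) fun j => by
      simp only [realIndicator, mem_univ, if_true, one_mul]
      rw [expect_eval (e j : Fin n × Fin m).1 (fun a => diag a (e j : Fin n × Fin m).2),
        expect_diag]
  refine ⟨x, hx, fun j => ⟨e j, ⟨(e j).2, by simpa [dictator] using hxe j⟩, ?_⟩⟩
  rintro d ⟨hdD, hd⟩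
  obtain ⟨j', hj'⟩ := e.surjective ⟨d, hdD⟩
  have h1 : d = e j' := by rw [hj']
  subst h1
  exact (hinj j j' (by simpa [dictator] using hd)).symm

end Configuration

lemma Finset.expect_realIndicator {m n : ℕ} (F : Finset (Fin n → Fin m)) :
    𝔼 x, F.realIndicator x = (F.dens : ℝ) := by
  rw [Fintype.expect_eq_sum_div_card]
  simp [Finset.realIndicator, Finset.dens]

theorem theorem7p5 {ℓ h : ℕ} (η : ℝ) (hη : 0 < η) (H : Configuration ℓ h)
    (hflat : H.IsFlat) (hker : H.kernel = ∅) :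
    ∃ C : ℕ, ∀ m n : ℕ, C < m → C < n →
      ∀ F : Finset (Fin n → Fin m), H.IsFree F →
        ∃ D : Finset (Fin n × Fin m), D.card < H.crosscut ∧
          ((F \ dictatorUnion D).dens : ℝ) ≤ η / m := by
  classical
  obtain ⟨ε, hε, C₁, hC₁⟩ := hflat.exists_isRealisedBy_of_sparse hη
  obtain ⟨C₂, hC₂⟩ := hflat.exists_isRealisedBy_of_dense hε
  obtain ⟨C₃, hC₃⟩ := hflat.exists_isCutBy
  refine ⟨C₁ + C₂ + C₃, fun m n hm hn F hF => ?_⟩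
  have : NeZero m := ⟨by omega⟩
  have : NeZero n := ⟨by omega⟩
  set D : Finset (Fin n × Fin m) :=
    {d | ε < 𝔼 x, F.realIndicator x * ProductSpace.diag (x d.1) d.2}
  have hDlt : #D < H.crosscut := by
    by_contra! hle
    obtain ⟨D', hD', hcard⟩ := exists_subset_card_eq hle
    obtain ⟨x, ⟨Φ₀, hΦ₀⟩, hx⟩ := hC₃ m n (by omega) (by omega) D' hcard
    choose d hd hduniq using hx
    have hxd : ∀ j, x j (d j).1 = (d j).2 := fun j => by simpa [dictator] using (hd j).2
    have heq : ∀ j j', x j' (d j).1 = (d j).2 → d j = d j' := fun j j' hjj =>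
      hduniq j' (d j) ⟨(hd j).1, by simpa [dictator] using hjj⟩
    -- `A` consists of the shared parts that the copy `x` places at the coordinate of the subcube of
    -- a sharing edge. All edges sharing there lie in that subcube, and uniqueness makes it the one
    -- assigned to each of them.
    obtain ⟨z, hz, hzr, -, -⟩ := hC₂ m n (by omega) (by omega) F d
      {k | ∃ j, k ∈ H.sharedParts j ∧ (d j).1 = Φ₀ k} Φ₀
      (by
        rintro k ⟨i, hik, hi⟩ j j' hjj hk
        have key : ∀ j, k ∈ H.sharedParts j → d i = d j := by
          intro j hj
          by_cases hij : i = j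
          · rw [hij]
          · refine heq i j ?_
            rw [← hxd i]
            exact ((hΦ₀ i j hij _).2 ⟨k, hi, hflat.edge_eq hik hj⟩).symm
        have h1 := key j (Configuration.mem_sharedParts.2 ⟨j', hjj.symm, hk⟩)
        have h2 := key j' (Configuration.mem_sharedParts.2 ⟨j, hjj, hk.symm⟩)
        exact ⟨h1.symm.trans h2, h1 ▸ hi⟩)
      (by
        intro j j' hjj he
        obtain ⟨k, hk, hke⟩ := (hΦ₀ j j' hjj (d j).1).1 (by rw [hxd j, he, hxd j'])
        exact ⟨k, ⟨j, Configuration.mem_sharedParts.2 ⟨j', hjj.symm, hke⟩, hk⟩, hke⟩)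
      (fun j => (mem_filter.1 (hD' (hd j).1)).2.le)
    exact hF ⟨z, hz, hzr⟩
  refine ⟨D, hDlt, ?_⟩
  by_contra! hlt
  set G := F \ dictatorUnion D
  have hdict : ∀ i a, 𝔼 x, G.realIndicator x * ProductSpace.diag (x i) a ≤ ε := by
    intro i a
    by_cases hia : (i, a) ∈ D
    · refine le_of_eq_of_le (expect_eq_zero fun x _ => ?_) hε.le
      by_cases hxa : x i = a
      · have : x ∉ G := fun hx => (mem_sdiff.1 hx).2
          (mem_biUnion.2 ⟨(i, a), hia, by simpa [dictator] using hxa⟩)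
        simp [realIndicator, this]
      · simp [ProductSpace.diag, hxa]
    · have h1 : 𝔼 x, F.realIndicator x * ProductSpace.diag (x i) a ≤ ε := by
        simpa [D] using hia
      refine le_trans (expect_le_expect fun x _ => ?_) h1
      have h2 : 0 ≤ ProductSpace.diag (x i) a := by
        unfold ProductSpace.diag; split_ifs <;> positivity
      refine mul_le_mul_of_nonneg_right ?_ h2
      unfold realIndicator
      split_ifs with h3 h4 h4
      · exact le_rfl
      · exact absurd (mem_sdiff.1 h3).1 h4
      · exact zero_le_one
      · exact le_rfl
  -- The measure of `G` is the average of its relative densities in the subcubes of a single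
  -- coordinate.
  have hμ : 𝔼 x, G.realIndicator x ≤ ε := by
    have h1 : 𝔼 a, 𝔼 x, G.realIndicator x * ProductSpace.diag (x 0) a
        = 𝔼 x, G.realIndicator x := by
      rw [expect_comm]
      refine expect_congr rfl fun x _ => ?_
      simp only [← mul_expect, ProductSpace.diag_comm (x 0), ProductSpace.expect_diag, mul_one]
    rw [← h1]
    exact expect_le univ_nonempty fun a _ => hdict 0 a
  obtain ⟨x, hx, hxr⟩ := hC₁ m n (by omega) (by omega) G
    (by rw [expect_realIndicator]; exact hlt.le) hμ hdict
  exact hF.mono sdiff_subset ⟨x, hx, hxr⟩
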